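/- Let $m\ge 6$. Consider complex-valued polynomials $f(\underline{x},\underline{y};\underline{z})$ in three vector variables $\underline{x},\underline{y},\underline{z}\in\mathbb{R}^m$, let $$D_s=\langle \underline{z},\underline{\partial}_y\rangle-\langle\underline{\partial}_x,\underline{\partial}_z\rangle$$ be the symplectic Dirac operator, and let $$\mathbb{S}_1^\infty=\ker(D_s)\cap\big(\mathcal{P}_1(\mathbb{R}^{2m},\mathbb{C})\otimes\mathcal{P}(\mathbb{R}^m,\mathbb{C})\big)$$ be the space of those $f$ with $D_sf=0$ that are homogeneous of degree $1$ in $(\underline{x},\underline{y})$ (with no restriction on the degree in $\underline{z}$). The Lie algebra $\mathfrak{so}(m)$ acts on $\mathbb{S}_1^\infty$ by the simultaneous infinitesimal rotations $\sum_{u\in\{x,y,z\}}(u_a\partial_{u_b}-u_b\partial_{u_a})$, and $\mathfrak{sl}(2)=\mathrm{span}\{X,Y,H\}$ (with $[H,X]=2X$, $[H,Y]=-2Y$, $[X,Y]=H$) acts by $$X\mapsto \langle \underline{y},\underline{\partial}_x\rangle+\tfrac12|\underline{z}|^2,\qquad Y\mapsto\langle\underline{x},\underline{\partial}_y\rangle-\tfrac12\Delta_z,\qquad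 H\mapsto \mathbb{E}_y-\mathbb{E}_x+\mathbb{E}_z+\tfrac m2,$$ where $\mathbb{E}_u=\sum_j u_j\partial_{u_j}$; these two actions commute. For $\lambda\in\mathbb{C}$ let $\mathbb{V}^\infty_\lambda$ be the lowest weight Verma module of $\mathfrak{sl}(2)$, with basis $X^nv$ $(n\in\mathbb{N})$ and $$X(X^nv)=X^{n+1}v,\qquad H(X^nv)=(\lambda+2n)X^nv,\qquad Y(X^nv)=-n(\lambda+n-1)X^{n-1}v .$$ Let $\mathcal{H}_a$ be the space of complex-valued harmonic polynomials on $\mathbb{R}^m$ that are homogeneous of degree $a$. Then the $\mathfrak{sl}(2)$-modules $\mathbb{V}^\infty_{\frac m2-1+n}$ $(n\in\mathbb{N})$ are irreducible, and as a module over $\mathfrak{so}(m)\times\mathfrak{sl}(2)$ $$\mathbb{S}_1^\infty\;\cong\;\bigoplus_{n=0}^\infty M_n\otimes\mathbb{V}^\infty_{\frac m2-1+n},\qquad M_n=\mathrm{Hom}_{\mathfrak{sl}(2)}\big(\mathbb{V}^\infty_{\frac m2-1+n},\mathbb{S}_1^\infty\big),$$ where $\mathfrak{so}(m)$ acts on $M_n$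 through $\mathbb{S}_1^\infty$, and all $M_n$ are finite-dimensional. The multiplicities $\dim M_n$ are as follows: 1. $\mathbb{V}^\infty_{\frac m2-1}$ occurs with multiplicity $m$; 2. $\mathbb{V}^\infty_{\frac m2}$ occurs with multiplicity $m^2-1$; 3. for every $a\ge 1$, $\mathbb{V}^\infty_{\frac m2+a}$ occurs with multiplicity $m\big(\dim\mathcal{H}_{a-1}+\dim\mathcal{H}_{a+1}\big)-\dim\mathcal{H}_a$. -/

import Mathlib

open scoped TensorProduct DirectSum

noncomputable section

namespace SympBranch

attribute [local instance] LieRing.ofAssociativeRing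

/-! ### The Lie algebras -/

/-- The complex Lie algebra `sl(2)` of traceless `2 × 2` matrices. -/
abbrev SL2 : Type := LieAlgebra.SpecialLinear.sl (Fin 2) ℂ

/-- The complex Lie algebra `so(m)` of skew-symmetric `m × m` matrices. -/
abbrev SO (m : ℕ) : Type := LieAlgebra.Orthogonal.so (Fin m) ℂ

/-- The Lie algebra `so(m) × sl(2)`. -/
abbrev SOSL2 (m : ℕ) : Type := SO m × SL2

lemma sl2_apply_one_one (A : SL2) : A.1 1 1 = -A.1 0 0 := by
  have h : Matrix.trace A.1 = 0 := A.2
  rw [Matrix.trace_fin_two] at h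
  linear_combination h

/-- The representation of `sl(2)` defined by three operators with
`[H, X] = 2X`, `[H, Y] = -2Y`, `[X, Y] = H`: the matrix `!![a, b; c, -a]` acts by
`a H + b X + c Y`. -/
def sl2Rep {V : Type*} [AddCommGroup V] [Module ℂ V] (X Y H : Module.End ℂ V)
    (hX : H * X - X * H = (2 : ℂ) • X) (hY : H * Y - Y * H = -((2 : ℂ) • Y))
    (hH : X * Y - Y * X = H) : SL2 →ₗ⁅ℂ⁆ Module.End ℂ V where
  toFun A := A.1 0 0 • H + A.1 0 1 • X + A.1 1 0 • Y
  map_add' A B := by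
    change (A.1 0 0 + B.1 0 0) • H + (A.1 0 1 + B.1 0 1) • X + (A.1 1 0 + B.1 1 0) • Y = _
    module
  map_smul' c A := by
    change (c * A.1 0 0) • H + (c * A.1 0 1) • X + (c * A.1 1 0) • Y = _
    rw [RingHom.id_apply]
    module
  map_lie' := by
    intro A B
    have h1 : H * X = X * H + (2 : ℂ) • X := by rw [← hX]; abel
    have h2 : H * Y = Y * H + -((2 : ℂ) • Y) := by rw [← hY]; abel
    have h3 : X * Y = Y * X + H := by rw [← hH]; abel
    rw [LieRing.of_associative_ring_bracket (A.1 0 0 • H + A.1 0 1 • X + A.1 1 0 • Y)]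
    simp only [LieAlgebra.SpecialLinear.sl_bracket, Matrix.sub_apply, Matrix.mul_apply,
      Fin.sum_univ_two, sl2_apply_one_one, mul_add, add_mul, smul_mul_smul_comm, h1, h2, h3]
    module

/-! ### Verma modules -/

/-- The Verma module of `sl(2)` with lowest weight `lam`, with basis `X ^ n v`, `n ∈ ℕ`, where `v`
is the lowest weight vector; `X ^ n v` is the basis vector `Finsupp.single n 1`. -/
def Verma (_lam : ℂ) : Type := ℕ →₀ ℂ

instance (lam : ℂ) : AddCommGroup (Verma lam) := inferInstanceAs (AddCommGroup (ℕ →₀ ℂ))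

instance (lam : ℂ) : Module ℂ (Verma lam) := inferInstanceAs (Module ℂ (ℕ →₀ ℂ))

/-- The basis vector `X ^ n v`. -/
def Verma.vec (lam : ℂ) (n : ℕ) : Verma lam := Finsupp.single n (1 : ℂ)

/-- The linear map that sends each `X ^ n v` to `f n`. -/
def Verma.lift (lam : ℂ) (f : ℕ → Verma lam) : Module.End ℂ (Verma lam) :=
  Finsupp.linearCombination ℂ f

lemma Verma.lift_vec (lam : ℂ) (f : ℕ → Verma lam) (n : ℕ) :
    Verma.lift lam f (Verma.vec lam n) = f n :=
  (Finsupp.linearCombination_single ℂ (1 : ℂ) n).trans (one_smul ℂ (f n))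

lemma Verma.end_ext (lam : ℂ) {f g : Module.End ℂ (Verma lam)}
    (h : ∀ n, f (Verma.vec lam n) = g (Verma.vec lam n)) : f = g :=
  Finsupp.lhom_ext' (R := ℂ) (M := ℂ) (N := Verma lam) (φ := f) (ψ := g)
    fun n => LinearMap.ext_ring (h n)

/-- `X (X ^ n v) = X ^ (n + 1) v`. -/
def Verma.opX (lam : ℂ) : Module.End ℂ (Verma lam) :=
  Verma.lift lam fun n => Verma.vec lam (n + 1)

/-- `Y (X ^ n v) = -n (lam + n - 1) X ^ (n - 1) v`; in particular `Y v = 0`. -/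
def Verma.opY (lam : ℂ) : Module.End ℂ (Verma lam) :=
  Verma.lift lam fun n => (-((n : ℂ) * (lam + n - 1))) • Verma.vec lam (n - 1)

/-- `H (X ^ n v) = (lam + 2 n) X ^ n v`. -/
def Verma.opH (lam : ℂ) : Module.End ℂ (Verma lam) :=
  Verma.lift lam fun n => (lam + 2 * n) • Verma.vec lam n

/-- The action of `sl(2)` on the Verma module. -/
def Verma.rep (lam : ℂ) : SL2 →ₗ⁅ℂ⁆ Module.End ℂ (Verma lam) :=
  sl2Rep (Verma.opX lam) (Verma.opY lam) (Verma.opH lam)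
    (by
      apply Verma.end_ext
      intro n
      simp only [LinearMap.sub_apply, Module.End.mul_apply, LinearMap.smul_apply, Verma.opX,
        Verma.opH, Verma.lift_vec, map_smul]
      push_cast
      module)
    (by
      apply Verma.end_ext
      intro n
      rcases n with _ | n
      · simp [Verma.opY, Verma.opH, Verma.lift_vec]
      · simp only [LinearMap.sub_apply, Module.End.mul_apply, LinearMap.smul_apply, Verma.opY,
          Verma.opH, Verma.lift_vec, map_smul, LinearMap.neg_apply, Nat.add_sub_cancel]
        push_cast
        module)
    (by
      apply Verma.end_ext
      intro n
      rcases n with _ | n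
      · simp [Verma.opX, Verma.opY, Verma.opH, Verma.lift_vec]
      · simp only [LinearMap.sub_apply, Module.End.mul_apply, Verma.opX, Verma.opY,
          Verma.opH, Verma.lift_vec, map_smul, Nat.add_sub_cancel]
        push_cast
        module)

instance (lam : ℂ) : LieRingModule SL2 (Verma lam) :=
  LieRingModule.compLieHom (Verma lam) (Verma.rep lam)

instance (lam : ℂ) : LieModule ℂ SL2 (Verma lam) :=
  LieModule.compLieHom (Verma lam) (Verma.rep lam)

/-- `so(m) × sl(2)` acts on a Verma module through its second factor. -/
instance (m : ℕ) (lam : ℂ) : LieRingModule (SOSL2 m) (Verma lam) :=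
  LieRingModule.compLieHom (Verma lam) (LieHom.snd ℂ (SO m) SL2)

instance (m : ℕ) (lam : ℂ) : LieModule ℂ (SOSL2 m) (Verma lam) :=
  LieModule.compLieHom (Verma lam) (LieHom.snd ℂ (SO m) SL2)

/-! ### Invariant operators in the Weyl algebra of three vector variables -/

/-- Names of the three vector variables. -/
inductive VecVar : Type
  | x | y | z
  deriving DecidableEq

instance : Fintype VecVar := ⟨{.x, .y, .z}, fun u => by cases u <;> simp⟩

lemma lie_mul' {A : Type*} [Ring A] (a b c : A) : ⁅a, b * c⁆ = ⁅a, b⁆ * c + b * ⁅a, c⁆ := by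
  simp only [Ring.lie_def]
  noncomm_ring

lemma mul_lie' {A : Type*} [Ring A] (a b c : A) : ⁅a * b, c⁆ = a * ⁅b, c⁆ + ⁅a, c⁆ * b := by
  simp only [Ring.lie_def]
  noncomm_ring

lemma one_lie' {A : Type*} [Ring A] (a : A) : ⁅(1 : A), a⁆ = 0 := by simp [Ring.lie_def]

lemma lie_one' {A : Type*} [Ring A] (a : A) : ⁅a, (1 : A)⁆ = 0 := by simp [Ring.lie_def]

section Weyl

set_option linter.unusedSectionVars false
set_option linter.unusedSimpArgs false

variable {m : ℕ} {A : Type*} [Ring A] [Algebra ℂ A]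

/-- The formal inner product `⟨a, b⟩ = ∑_j a_j b_j` of two vectors of operators. -/
def pair (a b : Fin m → A) : A := ∑ j, a j * b j

/-! In the next five definitions, `p u j` stands for the coordinate `u_j` and `q u j` stands for
the partial derivative `∂_{u_j}`, for `u ∈ {x, y, z}` and `1 ≤ j ≤ m`. -/

/-- The symplectic Dirac operator `D_s = ⟨z, ∂_y⟩ - ⟨∂_x, ∂_z⟩`. -/
def dirac (p q : VecVar → Fin m → A) : A := pair (p .z) (q .y) - pair (q .x) (q .z)

/-- The lowering operator `L = ⟨x, ∂_y⟩ - ½ Δ_z`. -/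
def opL (p q : VecVar → Fin m → A) : A := pair (p .x) (q .y) - (1 / 2 : ℂ) • pair (q .z) (q .z)

/-- The raising operator `R = ⟨y, ∂_x⟩ + ½ |z|²`. -/
def opR (p q : VecVar → Fin m → A) : A := pair (p .y) (q .x) + (1 / 2 : ℂ) • pair (p .z) (p .z)

/-- The operator `ℰ = 𝔼_y - 𝔼_x + 𝔼_z + m/2`, where `𝔼_u = ⟨u, ∂_u⟩`. -/
def opE (p q : VecVar → Fin m → A) : A :=
  pair (p .y) (q .y) - pair (p .x) (q .x) + pair (p .z) (q .z) + ((m : ℂ) / 2) • (1 : A)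

/-- The infinitesimal rotation `∑_{a,b} M_{ab} (x_a ∂_{x_b} + y_a ∂_{y_b} + z_a ∂_{z_b})` attached
to a matrix `M`. For `M = E_{ab} - E_{ba}` this is the angular momentum operator
`L_{ab}^{(x)} + L_{ab}^{(y)} + L_{ab}^{(z)}`. -/
def rot (p q : VecVar → Fin m → A) (M : Matrix (Fin m) (Fin m) ℂ) : A :=
  ∑ u : VecVar, ∑ a : Fin m, ∑ b : Fin m, M a b • (p u a * q u b)

/-- The canonical commutation relations. -/
structure IsWeyl (p q : VecVar → Fin m → A) : Prop where
  pp : ∀ u v i j, ⁅p u i, p v j⁆ = 0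
  qq : ∀ u v i j, ⁅q u i, q v j⁆ = 0
  qp : ∀ u v i j, ⁅q u i, p v j⁆ = if u = v ∧ i = j then 1 else 0

lemma smul_lie' (c : ℂ) (a b : A) : ⁅c • a, b⁆ = c • ⁅a, b⁆ := by
  simp [Ring.lie_def, smul_sub]

lemma lie_smul' (c : ℂ) (a b : A) : ⁅a, c • b⁆ = c • ⁅a, b⁆ := by
  simp [Ring.lie_def, smul_sub]

variable {p q : VecVar → Fin m → A}

lemma IsWeyl.pq (h : IsWeyl p q) (u v : VecVar) (i j : Fin m) :
    ⁅p u i, q v j⁆ = if u = v ∧ i = j then (-1 : A) else 0 := by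
  rw [← lie_skew, h.qp]
  by_cases h : u = v ∧ i = j
  · obtain ⟨rfl, rfl⟩ := h
    simp
  · rw [if_neg h, if_neg (fun h' => h ⟨h'.1.symm, h'.2.symm⟩), neg_zero]

lemma IsWeyl.md_p (h : IsWeyl p q) (u v w : VecVar) (j : Fin m) :
    ⁅pair (p u) (q v), p w j⁆ = if v = w then p u j else 0 := by
  rw [pair, sum_lie]
  by_cases e : v = w <;> simp [mul_lie', h.pp, h.qp, e]

lemma IsWeyl.md_q (h : IsWeyl p q) (u v w : VecVar) (j : Fin m) :
    ⁅pair (p u) (q v), q w j⁆ = if u = w then -q v j else 0 := by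
  rw [pair, sum_lie]
  by_cases e : u = w <;> simp [mul_lie', h.qq, h.pq, e]

lemma IsWeyl.dd_p (h : IsWeyl p q) (u v w : VecVar) (j : Fin m) :
    ⁅pair (q u) (q v), p w j⁆ =
      (if v = w then q u j else 0) + (if u = w then q v j else 0) := by
  rw [pair, sum_lie]
  by_cases e : v = w <;> by_cases e' : u = w <;>
    simp [mul_lie', h.qp, e, e', Finset.sum_add_distrib]

lemma IsWeyl.dd_q (h : IsWeyl p q) (u v w : VecVar) (j : Fin m) :
    ⁅pair (q u) (q v), q w j⁆ = 0 := by
  rw [pair, sum_lie]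
  simp [mul_lie', h.qq]

lemma IsWeyl.mm_p (h : IsWeyl p q) (u v w : VecVar) (j : Fin m) :
    ⁅pair (p u) (p v), p w j⁆ = 0 := by
  rw [pair, sum_lie]
  simp [mul_lie', h.pp]

lemma IsWeyl.mm_q (h : IsWeyl p q) (u v w : VecVar) (j : Fin m) :
    ⁅pair (p u) (p v), q w j⁆ =
      (if v = w then -p u j else 0) + (if u = w then -p v j else 0) := by
  rw [pair, sum_lie]
  by_cases e : v = w <;> by_cases e' : u = w <;>
    simp [mul_lie', h.pq, e, e', Finset.sum_add_distrib]

lemma IsWeyl.lie_opE_opR (h : IsWeyl p q) : ⁅opE p q, opR p q⁆ = (2 : ℂ) • opR p q := by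
  rw [opR, lie_add, lie_smul', pair, pair, lie_sum, lie_sum]
  simp only [lie_mul', opE, add_lie, sub_lie, smul_lie', one_lie', h.md_p, h.md_q]
  simp only [reduceCtorEq, if_true, if_false, smul_add, Finset.smul_sum, ← Finset.sum_add_distrib]
  refine Finset.sum_congr rfl fun j _ => ?_
  simp
  module

lemma IsWeyl.lie_opE_opL (h : IsWeyl p q) : ⁅opE p q, opL p q⁆ = -((2 : ℂ) • opL p q) := by
  rw [opL, lie_sub, lie_smul', pair, pair, lie_sum, lie_sum]
  simp only [lie_mul', opE, add_lie, sub_lie, smul_lie', one_lie', h.md_p, h.md_q]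
  simp only [reduceCtorEq, if_true, if_false, smul_sub, Finset.smul_sum, ← Finset.sum_sub_distrib,
    ← Finset.sum_neg_distrib]
  refine Finset.sum_congr rfl fun j _ => ?_
  simp
  module

lemma IsWeyl.q_mul_p (h : IsWeyl p q) (u : VecVar) (j : Fin m) :
    q u j * p u j = p u j * q u j + 1 := by
  have h := h.qp u u j j
  rw [Ring.lie_def, if_pos ⟨rfl, rfl⟩] at h
  rw [← h]
  abel

lemma IsWeyl.lie_opR_opL (h : IsWeyl p q) : ⁅opR p q, opL p q⁆ = opE p q := by
  have hm : ((m : ℂ) / 2) • (1 : A) = ∑ _j : Fin m, (1 / 2 : ℂ) • (1 : A) := by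
    rw [Finset.sum_const, Finset.card_univ, Fintype.card_fin, ← Nat.cast_smul_eq_nsmul ℂ, smul_smul]
    congr 1
    ring
  rw [opE, hm, opL, lie_sub, lie_smul', pair, pair, lie_sum, lie_sum]
  simp only [lie_mul', opR, add_lie, smul_lie', h.md_p, h.md_q, h.mm_p, h.mm_q]
  simp only [pair, Finset.smul_sum, ← Finset.sum_sub_distrib, ← Finset.sum_add_distrib]
  refine Finset.sum_congr rfl fun j _ => ?_
  simp [mul_add, add_mul, h.q_mul_p]
  module

lemma IsWeyl.lie_opL_dirac (h : IsWeyl p q) : ⁅opL p q, dirac p q⁆ = 0 := by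
  rw [dirac, lie_sub, pair, pair, lie_sum, lie_sum, ← Finset.sum_sub_distrib]
  refine Finset.sum_eq_zero fun j _ => ?_
  simp only [lie_mul', opL, sub_lie, smul_lie', h.md_p, h.md_q, h.dd_p, h.dd_q]
  have h := h.qq .y .z j j
  rw [Ring.lie_def, sub_eq_zero] at h
  simp [← two_smul ℂ, smul_smul, h]

lemma IsWeyl.lie_opR_dirac (h : IsWeyl p q) : ⁅opR p q, dirac p q⁆ = 0 := by
  rw [dirac, lie_sub, pair, pair, lie_sum, lie_sum, ← Finset.sum_sub_distrib]
  refine Finset.sum_eq_zero fun j _ => ?_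
  simp only [lie_mul', opR, add_lie, smul_lie', h.md_p, h.md_q, h.mm_p, h.mm_q]
  have h := h.qp .x .z j j
  rw [Ring.lie_def, if_neg (by simp), sub_eq_zero] at h
  simp [← two_smul ℂ, smul_smul, h]

lemma IsWeyl.lie_opE_dirac (h : IsWeyl p q) : ⁅opE p q, dirac p q⁆ = 0 := by
  rw [dirac, lie_sub, pair, pair, lie_sum, lie_sum, ← Finset.sum_sub_distrib]
  refine Finset.sum_eq_zero fun j _ => ?_
  simp [lie_mul', opE, add_lie, sub_lie, smul_lie', one_lie', h.md_p, h.md_q]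

lemma IsWeyl.rot_p (h : IsWeyl p q) (M : Matrix (Fin m) (Fin m) ℂ) (w : VecVar) (j : Fin m) :
    ⁅rot p q M, p w j⁆ = ∑ a, M a j • p w a := by
  rw [rot, sum_lie, Finset.sum_eq_single w]
  · rw [sum_lie]
    refine Finset.sum_congr rfl fun a _ => ?_
    rw [sum_lie, Finset.sum_eq_single j]
    · simp [smul_lie', mul_lie', h.pp, h.qp]
    · intro b _ hb
      simp [smul_lie', mul_lie', h.pp, h.qp, hb]
    · simp
  · intro u _ hu
    rw [sum_lie]
    refine Finset.sum_eq_zero fun a _ => ?_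
    rw [sum_lie]
    refine Finset.sum_eq_zero fun b _ => ?_
    simp [smul_lie', mul_lie', h.pp, h.qp, hu]
  · simp

lemma IsWeyl.rot_q (h : IsWeyl p q) (M : Matrix (Fin m) (Fin m) ℂ) (w : VecVar) (j : Fin m) :
    ⁅rot p q M, q w j⁆ = ∑ b, (-M j b) • q w b := by
  rw [rot, sum_lie, Finset.sum_eq_single w]
  · rw [sum_lie, Finset.sum_eq_single j]
    · rw [sum_lie]
      refine Finset.sum_congr rfl fun b _ => ?_
      simp [smul_lie', mul_lie', h.qq, h.pq]
    · intro b _ hb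
      rw [sum_lie]
      refine Finset.sum_eq_zero fun a _ => ?_
      simp [smul_lie', mul_lie', h.qq, h.pq, hb]
    · simp
  · intro u _ hu
    rw [sum_lie]
    refine Finset.sum_eq_zero fun a _ => ?_
    rw [sum_lie]
    refine Finset.sum_eq_zero fun b _ => ?_
    simp [smul_lie', mul_lie', h.qq, h.pq, hu]
  · simp

lemma IsWeyl.rot_md (h : IsWeyl p q) (M : Matrix (Fin m) (Fin m) ℂ) (u v : VecVar) :
    ⁅rot p q M, pair (p u) (q v)⁆ = 0 := by
  rw [pair, lie_sum]
  simp only [lie_mul', h.rot_p, h.rot_q, Finset.sum_add_distrib, Finset.sum_mul, Finset.mul_sum]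
  rw [Finset.sum_comm, ← Finset.sum_add_distrib]
  refine Finset.sum_eq_zero fun a _ => ?_
  rw [← Finset.sum_add_distrib]
  refine Finset.sum_eq_zero fun b _ => ?_
  simp

lemma so_apply (M : SO m) (a b : Fin m) : M.1 a b = -M.1 b a := by
  have h := (LieAlgebra.Orthogonal.mem_so (n := Fin m) (R := ℂ) M.1).1 M.2
  exact congrFun (congrFun h b) a

lemma IsWeyl.rot_mm (h : IsWeyl p q) (M : SO m) (u v : VecVar) :
    ⁅rot p q M.1, pair (p u) (p v)⁆ = 0 := by
  rw [pair, lie_sum]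
  simp only [lie_mul', h.rot_p, Finset.sum_add_distrib, Finset.sum_mul, Finset.mul_sum]
  rw [Finset.sum_comm, ← Finset.sum_add_distrib]
  refine Finset.sum_eq_zero fun a _ => ?_
  rw [← Finset.sum_add_distrib]
  refine Finset.sum_eq_zero fun b _ => ?_
  rw [so_apply M a b]
  simp

lemma IsWeyl.rot_dd (h : IsWeyl p q) (M : SO m) (u v : VecVar) :
    ⁅rot p q M.1, pair (q u) (q v)⁆ = 0 := by
  rw [pair, lie_sum]
  simp only [lie_mul', h.rot_q, Finset.sum_add_distrib, Finset.sum_mul, Finset.mul_sum]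
  rw [Finset.sum_comm, ← Finset.sum_add_distrib]
  refine Finset.sum_eq_zero fun a _ => ?_
  rw [← Finset.sum_add_distrib]
  refine Finset.sum_eq_zero fun b _ => ?_
  rw [so_apply M a b]
  simp

lemma IsWeyl.rot_dirac (h : IsWeyl p q) (M : SO m) : ⁅rot p q M.1, dirac p q⁆ = 0 := by
  rw [dirac, lie_sub, h.rot_md, h.rot_dd, sub_zero]

lemma IsWeyl.rot_opL (h : IsWeyl p q) (M : SO m) : ⁅rot p q M.1, opL p q⁆ = 0 := by
  rw [opL, lie_sub, lie_smul', h.rot_md, h.rot_dd, smul_zero, sub_zero]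

lemma IsWeyl.rot_opR (h : IsWeyl p q) (M : SO m) : ⁅rot p q M.1, opR p q⁆ = 0 := by
  rw [opR, lie_add, lie_smul', h.rot_md, h.rot_mm, smul_zero, add_zero]

lemma IsWeyl.rot_opE (h : IsWeyl p q) (M : SO m) : ⁅rot p q M.1, opE p q⁆ = 0 := by
  rw [opE, lie_add, lie_add, lie_sub, lie_smul', h.rot_md, h.rot_md, h.rot_md, lie_one']
  simp

lemma IsWeyl.rot_lie (h : IsWeyl p q) (M N : Matrix (Fin m) (Fin m) ℂ) :
    rot p q (M * N - N * M) = ⁅rot p q M, rot p q N⁆ := by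
  rw [rot, rot.eq_def p q N, lie_sum]
  refine Finset.sum_congr rfl fun u _ => ?_
  rw [lie_sum]
  simp only [lie_sum, lie_smul', lie_mul', h.rot_p, h.rot_q, Matrix.sub_apply, Finset.sum_mul,
    Matrix.mul_apply, sub_smul, Finset.sum_sub_distrib, Finset.mul_sum, smul_add,
    Finset.sum_add_distrib, Finset.smul_sum, Finset.sum_smul, smul_mul_assoc, mul_smul_comm,
    neg_smul, smul_neg, smul_smul, Finset.sum_neg_distrib]
  rw [sub_eq_add_neg]
  congr 1
  · calc _ = ∑ b, ∑ a, ∑ c, (M a c * N c b) • (p u a * q u b) := Finset.sum_comm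
      _ = ∑ b, ∑ c, ∑ a, (M a c * N c b) • (p u a * q u b) :=
        Finset.sum_congr rfl fun _ _ => Finset.sum_comm
      _ = ∑ c, ∑ b, ∑ a, (M a c * N c b) • (p u a * q u b) := Finset.sum_comm
      _ = _ := by simp only [mul_comm]
  · simp only [Finset.mul_sum, mul_neg, mul_smul_comm, smul_neg, Finset.smul_sum, smul_smul,
      Finset.sum_neg_distrib]
    congr 1
    exact Finset.sum_congr rfl fun _ _ => Finset.sum_comm

section Subalg

variable (S : Subalgebra ℂ A)

lemma opL_mem (hpq : ∀ u v i j, (u = .z ↔ v = .z) → p u i * q v j ∈ S)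
    (hq : ∀ i, q .z i ∈ S) : opL p q ∈ S :=
  S.sub_mem (S.sum_mem fun _ _ => hpq _ _ _ _ (by simp))
    (S.smul_mem (S.sum_mem fun _ _ => S.mul_mem (hq _) (hq _)) _)

lemma opR_mem (hpq : ∀ u v i j, (u = .z ↔ v = .z) → p u i * q v j ∈ S)
    (hp : ∀ i, p .z i ∈ S) : opR p q ∈ S :=
  S.add_mem (S.sum_mem fun _ _ => hpq _ _ _ _ (by simp))
    (S.smul_mem (S.sum_mem fun _ _ => S.mul_mem (hp _) (hp _)) _)

lemma opE_mem (hpq : ∀ u v i j, (u = .z ↔ v = .z) → p u i * q v j ∈ S) : opE p q ∈ S :=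
  S.add_mem (S.add_mem (S.sub_mem (S.sum_mem fun _ _ => hpq _ _ _ _ (by simp))
    (S.sum_mem fun _ _ => hpq _ _ _ _ (by simp))) (S.sum_mem fun _ _ => hpq _ _ _ _ (by simp)))
    (S.smul_mem S.one_mem _)

lemma rot_mem (hpq : ∀ u v i j, (u = .z ↔ v = .z) → p u i * q v j ∈ S)
    (M : Matrix (Fin m) (Fin m) ℂ) : rot p q M ∈ S :=
  S.sum_mem fun _ _ => S.sum_mem fun _ _ => S.sum_mem fun _ _ =>
    S.smul_mem (hpq _ _ _ _ Iff.rfl) _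

end Subalg

end Weyl

/-! ### The action of `so(m) × sl(2)` -/

section Action

variable {m : ℕ} {V : Type*} [AddCommGroup V] [Module ℂ V] {p q : VecVar → Fin m → Module.End ℂ V}

/-- `so(m)` acts by infinitesimal rotations of `x`, `y` and `z`. -/
def IsWeyl.soRep (h : IsWeyl p q) : SO m →ₗ⁅ℂ⁆ Module.End ℂ V where
  toFun M := rot p q M.1
  map_add' M N := by
    change rot p q (M.1 + N.1) = _
    simp only [rot, Matrix.add_apply, add_smul, Finset.sum_add_distrib]
  map_smul' c M := by
    change rot p q (c • M.1) = _
    simp only [rot, Matrix.smul_apply, smul_eq_mul, mul_smul, Finset.smul_sum,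
      RingHom.id_apply]
  map_lie' := fun {M N} => h.rot_lie M.1 N.1

/-- `sl(2)` acts by `X ↦ R`, `Y ↦ L`, `H ↦ ℰ`. -/
def IsWeyl.sldRep (h : IsWeyl p q) : SL2 →ₗ⁅ℂ⁆ Module.End ℂ V :=
  sl2Rep (opR p q) (opL p q) (opE p q) h.lie_opE_opR h.lie_opE_opL h.lie_opR_opL

lemma IsWeyl.lie_soRep_sldRep (h : IsWeyl p q) (M : SO m) (B : SL2) :
    ⁅h.soRep M, h.sldRep B⁆ = 0 := by
  change ⁅rot p q M.1, B.1 0 0 • opE p q + B.1 0 1 • opR p q + B.1 1 0 • opL p q⁆ = 0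
  rw [lie_add, lie_add, lie_smul', lie_smul', lie_smul', h.rot_opE, h.rot_opR, h.rot_opL]
  simp

/-- The action of `so(m) × sl(2)`. -/
def IsWeyl.action (h : IsWeyl p q) : SOSL2 m →ₗ⁅ℂ⁆ Module.End ℂ V where
  toFun g := h.soRep g.1 + h.sldRep g.2
  map_add' g g' := by
    simp only [Prod.fst_add, Prod.snd_add, map_add]
    abel
  map_smul' c g := by
    simp only [Prod.smul_fst, Prod.smul_snd, map_smul, RingHom.id_apply, smul_add]
  map_lie' := fun {g g'} => by
    have h1 := h.lie_soRep_sldRep g'.1 g.2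
    rw [← lie_skew, neg_eq_zero] at h1
    change h.soRep ⁅g.1, g'.1⁆ + h.sldRep ⁅g.2, g'.2⁆ = _
    rw [LieHom.map_lie, LieHom.map_lie, lie_add, add_lie, add_lie, h.lie_soRep_sldRep, h1]
    abel

lemma IsWeyl.lie_action_dirac (h : IsWeyl p q) (g : SOSL2 m) : ⁅h.action g, dirac p q⁆ = 0 := by
  change ⁅rot p q g.1.1 + (g.2.1 0 0 • opE p q + g.2.1 0 1 • opR p q +
    g.2.1 1 0 • opL p q), dirac p q⁆ = 0
  rw [add_lie, add_lie, add_lie, smul_lie', smul_lie', smul_lie', h.rot_dirac,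
    h.lie_opE_dirac, h.lie_opR_dirac, h.lie_opL_dirac]
  simp

end Action

/-! ### Polynomials in three vector variables -/

/-- The scalar coordinates `x_j`, `y_j`, `z_j` with `1 ≤ j ≤ m`. -/
abbrev Coord (m : ℕ) : Type := VecVar × Fin m

/-- Complex-valued polynomials in `(x, y; z)`, that is,
`𝒫(ℝ^{2m}, ℂ) ⊗ 𝒫(ℝ^m, ℂ) = 𝒫(ℝ^{3m}, ℂ)`. -/
abbrev SpinorPoly (m : ℕ) : Type := MvPolynomial (Coord m) ℂ

section Poly

variable {m : ℕ}

/-- Multiplication by the coordinate `u_j`. -/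
def mulC (u : VecVar) (j : Fin m) : Module.End ℂ (SpinorPoly m) :=
  LinearMap.mulLeft ℂ (MvPolynomial.X (u, j))

/-- The partial derivative `∂_{u_j}`. -/
def derC (u : VecVar) (j : Fin m) : Module.End ℂ (SpinorPoly m) :=
  (MvPolynomial.pderiv (u, j) : Derivation ℂ (SpinorPoly m) (SpinorPoly m)).toLinearMap

lemma mulC_apply (u : VecVar) (i : Fin m) (f : SpinorPoly m) :
    mulC u i f = MvPolynomial.X (u, i) * f := rfl

lemma derC_apply (u : VecVar) (i : Fin m) (f : SpinorPoly m) :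
    derC u i f = MvPolynomial.pderiv (u, i) f := rfl

lemma pderiv_comm {σ : Type*} (i j : σ) (f : MvPolynomial σ ℂ) :
    MvPolynomial.pderiv i (MvPolynomial.pderiv j f) =
      MvPolynomial.pderiv j (MvPolynomial.pderiv i f) := by
  classical
  induction f using MvPolynomial.induction_on with
  | C a => simp
  | add f g hf hg => simp [hf, hg]
  | mul_X f k hf =>
    simp only [Derivation.leibniz, map_add, smul_eq_mul, hf, MvPolynomial.pderiv_X, Pi.single_apply]
    split_ifs <;> simp <;> ring

lemma isWeyl (m : ℕ) : IsWeyl (mulC (m := m)) derC where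
  pp u v i j := by
    rw [Ring.lie_def]
    refine LinearMap.ext fun f => ?_
    simp only [LinearMap.sub_apply, Module.End.mul_apply, mulC_apply, LinearMap.zero_apply]
    ring
  qq u v i j := by
    rw [Ring.lie_def]
    refine LinearMap.ext fun f => ?_
    simp only [LinearMap.sub_apply, Module.End.mul_apply, derC_apply, LinearMap.zero_apply]
    rw [pderiv_comm, sub_self]
  qp u v i j := by
    rw [Ring.lie_def]
    refine LinearMap.ext fun f => ?_
    simp only [LinearMap.sub_apply, Module.End.mul_apply, derC_apply, mulC_apply,
      Derivation.leibniz, smul_eq_mul]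
    by_cases h : u = v ∧ i = j
    · obtain ⟨rfl, rfl⟩ := h
      simp
    · rw [if_neg h, MvPolynomial.pderiv_X_of_ne (fun h' => h (by simpa [eq_comm] using h'))]
      simp

/-- The weights that measure the degree of homogeneity in `(x, y)`. -/
def xyWeight (m : ℕ) : Coord m → ℕ
  | (.x, _) => 1
  | (.y, _) => 1
  | (.z, _) => 0

/-- `f` is homogeneous of degree `k` in `(x, y)`, that is, `f` belongs to
`𝒫_k(ℝ^{2m}, ℂ) ⊗ 𝒫(ℝ^m, ℂ)`. -/
def IsHomogXY (k : ℕ) (f : SpinorPoly m) : Prop :=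
  MvPolynomial.IsWeightedHomogeneous (xyWeight m) f k

lemma pderiv_eq_zero {k : ℕ} {f : SpinorPoly m} (hf : IsHomogXY k f) (j : Coord m)
    (hk : k < xyWeight m j) : MvPolynomial.pderiv j f = 0 := by
  classical
  refine MvPolynomial.ext _ _ fun d => ?_
  rw [MvPolynomial.coeff_pderiv, MvPolynomial.coeff_zero,
    MvPolynomial.IsWeightedHomogeneous.coeff_eq_zero hf, zero_mul]
  rw [map_add, Finsupp.weight_single]
  simp only [smul_eq_mul, one_mul]
  omega

variable (m) in
/-- The algebra of operators that preserve the degree of homogeneity in `(x, y)`. -/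
def presXY : Subalgebra ℂ (Module.End ℂ (SpinorPoly m)) where
  carrier := {T | ∀ k f, IsHomogXY k f → IsHomogXY k (T f)}
  mul_mem' := fun hS hT k f hf => hS k _ (hT k f hf)
  add_mem' := fun hS hT k f hf =>
    (MvPolynomial.weightedHomogeneousSubmodule ℂ (xyWeight m) k).add_mem (hS k f hf) (hT k f hf)
  algebraMap_mem' := fun c k _ hf =>
    (MvPolynomial.weightedHomogeneousSubmodule ℂ (xyWeight m) k).smul_mem c hf

lemma mulC_derC_mem (u v : VecVar) (i j : Fin m) (huv : u = .z ↔ v = .z) :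
    mulC u i * derC v j ∈ presXY m := by
  have h : xyWeight m (u, i) = xyWeight m (v, j) := by
    cases u <;> cases v <;> simp_all [xyWeight]
  intro k f hf
  rw [Module.End.mul_apply, mulC_apply, derC_apply]
  by_cases hk : k < xyWeight m (v, j)
  · rw [pderiv_eq_zero hf _ hk, mul_zero]
    exact MvPolynomial.isWeightedHomogeneous_zero _ _ _
  · have h1 := MvPolynomial.IsWeightedHomogeneous.pderiv (i := (v, j))
      (n' := k - xyWeight m (v, j)) hf (by omega)
    have h2 := (MvPolynomial.isWeightedHomogeneous_X ℂ (xyWeight m) (u, i)).mul h1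
    rwa [h, Nat.add_sub_cancel' (by omega)] at h2

lemma mulC_z_mem (i : Fin m) : mulC .z i ∈ presXY m := by
  intro k f hf
  have h := (MvPolynomial.isWeightedHomogeneous_X ℂ (xyWeight m) (.z, i)).mul hf
  rw [show xyWeight m (.z, i) = 0 from rfl, zero_add] at h
  exact h

lemma derC_z_mem (i : Fin m) : derC .z i ∈ presXY m := fun k f hf =>
  MvPolynomial.IsWeightedHomogeneous.pderiv (i := (VecVar.z, i)) (n' := k) hf (by simp [xyWeight])

/-! ### Symplectic monogenics -/

instance (m : ℕ) : LieRingModule (SOSL2 m) (SpinorPoly m) :=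
  LieRingModule.compLieHom (SpinorPoly m) (isWeyl m).action

instance (m : ℕ) : LieModule ℂ (SOSL2 m) (SpinorPoly m) :=
  LieModule.compLieHom (SpinorPoly m) (isWeyl m).action

/-- `(M, B) ∈ so(m) × sl(2)` acts on polynomials by the infinitesimal rotation attached to `M` plus
`a ℰ + b R + c L`, where `B = !![a, b; c, -a]`. -/
lemma lie_apply (g : SOSL2 m) (f : SpinorPoly m) :
    ⁅g, f⁆ = (rot mulC derC g.1.1 + (g.2.1 0 0 • opE mulC derC + g.2.1 0 1 • opR mulC derC +
      g.2.1 1 0 • opL mulC derC) : Module.End ℂ (SpinorPoly m)) f := rfl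

lemma action_mem (g : SOSL2 m) : (isWeyl m).action g ∈ presXY m :=
  (presXY m).add_mem (rot_mem _ mulC_derC_mem g.1.1)
    ((presXY m).add_mem ((presXY m).add_mem
      ((presXY m).smul_mem (opE_mem _ mulC_derC_mem) _)
      ((presXY m).smul_mem (opR_mem _ mulC_derC_mem mulC_z_mem) _))
      ((presXY m).smul_mem (opL_mem _ mulC_derC_mem derC_z_mem) _))

/-- The space `𝕊_k^∞ = ker(D_s) ∩ (𝒫_k(ℝ^{2m}, ℂ) ⊗ 𝒫(ℝ^m, ℂ))` of `k`-homogeneous symplectic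
monogenics, as a module over `so(m) × sl(2)`. -/
def Monogenic (m k : ℕ) : LieSubmodule ℂ (SOSL2 m) (SpinorPoly m) where
  carrier := {f | IsHomogXY k f ∧ dirac mulC derC f = 0}
  add_mem' := fun {f g} hf hg =>
    ⟨(MvPolynomial.weightedHomogeneousSubmodule ℂ (xyWeight m) k).add_mem hf.1 hg.1, by
      rw [map_add, hf.2, hg.2, add_zero]⟩
  zero_mem' := ⟨MvPolynomial.isWeightedHomogeneous_zero _ _ _, map_zero _⟩
  smul_mem' c f hf :=
    ⟨(MvPolynomial.weightedHomogeneousSubmodule ℂ (xyWeight m) k).smul_mem c hf.1, by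
      rw [map_smul, hf.2, smul_zero]⟩
  lie_mem := fun {g f} hf => by
    refine ⟨action_mem g k f hf.1, ?_⟩
    have h := congrArg (fun T : Module.End ℂ (SpinorPoly m) => T f) ((isWeyl m).lie_action_dirac g)
    simp only [Ring.lie_def, LinearMap.sub_apply, Module.End.mul_apply, LinearMap.zero_apply,
      sub_eq_zero] at h
    exact h.symm.trans (by rw [hf.2, map_zero])

end Poly

/-! ### Multiplicity spaces -/

instance (m k : ℕ) : LieRingModule SL2 (Monogenic m k) :=
  LieRingModule.compLieHom (Monogenic m k) (LieHom.inr ℂ (SO m) SL2)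

instance (m k : ℕ) : LieModule ℂ SL2 (Monogenic m k) :=
  LieModule.compLieHom (Monogenic m k) (LieHom.inr ℂ (SO m) SL2)

lemma sl2_lie_def {m k : ℕ} (B : SL2) (f : Monogenic m k) : ⁅B, f⁆ = ⁅((0, B) : SOSL2 m), f⁆ := rfl

/-- The multiplicity space of the `sl(2)`-module `𝕍_lam^∞` in `𝕊_k^∞`, that is, the space
`Hom_{sl(2)}(𝕍_lam^∞, 𝕊_k^∞)` of homomorphisms of `sl(2)`-modules. -/
abbrev MultSpace (m k : ℕ) (lam : ℂ) : Type := Verma lam →ₗ⁅ℂ, SL2⁆ Monogenic m k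

lemma lie_commute {m k : ℕ} (M : SO m) (B : SL2) (f : Monogenic m k) :
    ⁅((M, 0) : SOSL2 m), ⁅B, f⁆⁆ = ⁅B, ⁅((M, 0) : SOSL2 m), f⁆⁆ := by
  rw [sl2_lie_def, sl2_lie_def, leibniz_lie]
  simp [LieAlgebra.Prod.bracket_apply, Prod.mk_zero_zero]

/-- `so(m)` acts on the multiplicity spaces through its action on `𝕊_k^∞`; the factor `sl(2)` acts
trivially. -/
instance (m k : ℕ) (lam : ℂ) : LieRingModule (SOSL2 m) (MultSpace m k lam) where
  bracket g φ :=
    { toFun := fun v => ⁅((g.1, 0) : SOSL2 m), φ v⁆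
      map_add' := fun v w => by rw [map_add, lie_add]
      map_smul' := fun c v => by rw [map_smul, lie_smul, RingHom.id_apply]
      map_lie' := fun {B v} => by rw [LieModuleHom.map_lie, lie_commute] }
  add_lie g h φ := by
    ext1 v
    change ⁅((g.1 + h.1, 0) : SOSL2 m), φ v⁆ =
      ⁅((g.1, 0) : SOSL2 m), φ v⁆ + ⁅((h.1, 0) : SOSL2 m), φ v⁆
    rw [← add_lie, Prod.mk_add_mk, add_zero]
  lie_add g φ ψ := by
    ext1 v
    exact lie_add ((g.1, 0) : SOSL2 m) (φ v) (ψ v)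
  leibniz_lie g h φ := by
    ext1 v
    change ⁅((g.1, 0) : SOSL2 m), ⁅((h.1, 0) : SOSL2 m), φ v⁆⁆ =
      ⁅((⁅g.1, h.1⁆, 0) : SOSL2 m), φ v⁆ + ⁅((h.1, 0) : SOSL2 m), ⁅((g.1, 0) : SOSL2 m), φ v⁆⁆
    rw [leibniz_lie]
    simp [LieAlgebra.Prod.bracket_apply]

instance (m k : ℕ) (lam : ℂ) : LieModule ℂ (SOSL2 m) (MultSpace m k lam) where
  smul_lie c g φ := by
    ext1 v
    change ⁅((c • g.1, 0) : SOSL2 m), φ v⁆ = c • ⁅((g.1, 0) : SOSL2 m), φ v⁆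
    rw [← smul_lie, Prod.smul_mk, smul_zero]
  lie_smul c g φ := by
    ext1 v
    exact lie_smul c ((g.1, 0) : SOSL2 m) (φ v)

/-! ### Harmonic polynomials -/

/-- The Laplace operator `∑_j ∂_{z_j}²` on complex-valued polynomials on `ℝ^m`. -/
def laplace (m : ℕ) : Module.End ℂ (MvPolynomial (Fin m) ℂ) :=
  ∑ j : Fin m, (MvPolynomial.pderiv j).toLinearMap ∘ₗ (MvPolynomial.pderiv j).toLinearMap

/-- The space `ℋ_a` of `a`-homogeneous harmonic polynomials on `ℝ^m`. -/
def harmonics (m a : ℕ) : Submodule ℂ (MvPolynomial (Fin m) ℂ) :=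
  MvPolynomial.homogeneousSubmodule (Fin m) ℂ a ⊓ LinearMap.ker (laplace m)

end SympBranch

end

/-!
Write a polynomial that is linear in `(x, y)` as `f = ∑_j x_j A_j(z) + y_j B_j(z)`. Then `𝕊_1^∞` is
the kernel of an `sl(2)`-equivariant map `D_s` from these polynomials, which form `2m` copies of
`𝒫(ℝ^m, ℂ)`, to `𝒫(ℝ^m, ℂ)`.

The decomposition. In an `sl(2)`-module in which `H` is diagonalizable and all weights have positive
real part, `Y` lowers weights and is therefore locally nilpotent, and `Y X^{k+1} w` is a nonzero
multiple of `X^k w` for every lowest weight vector `w ≠ 0`. Induction on the weight shows that every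
vector is a combination of vectors `X^k w` (`PositiveWeights.weightH_le_generated`), which says that
the evaluation map `⨁ Hom(𝕍_lam, V) ⊗ 𝕍_lam → V` is surjective (`evalSum_surjective`). It is
injective (`evalSum_injective`): the Casimir operator separates the summands with different `lam`,
and within one summand the weights separate the vectors `X^k w`. On `𝕊_1^∞` all weights are of the
form `m/2 - 1 + n`, and `H` is diagonalizable there because `D_s` commutes with it.

The multiplicities. The same induction shows that `Y` maps the weight space of weight `μ` onto the
one of weight `μ - 2`, so that the multiplicity of `𝕍_μ` is the difference of the two dimensions
(`PositiveWeights.finrank_lowest`). On `𝒫(ℝ^m, ℂ) = 𝕊_0^∞` the lowest weight vectors are the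
harmonic polynomials, `ℋ_a` having weight `m/2 + a` (`map_toPoly_lowest_zero`). Let `h(μ)` be the
dimension of the space of those of weight `μ`. The variables `x_j` and `y_j` shift weights by `-1`
and `1`, and `D_s` is surjective, since it maps `⟨x, z⟩ g` to `-(m + deg g) g`
(`map_dirac_homogWeight`). Hence the multiplicity of `𝕍_μ` in `𝕊_1^∞` is
`m (h(μ - 1) + h(μ + 1)) - h(μ)` (`finrank_lowest_one`), which gives the three cases, as `h(μ) = 0`
for `μ < m/2`.
-/

noncomputable section

namespace SympBranch

attribute [local instance] LieRing.ofAssociativeRing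

open LieModule Module

/-! ### Standard generators of `sl(2)` -/

/-- The raising generator `X` of `sl(2)`. -/
def eX : SL2 :=
  ⟨!![0, 1; 0, 0], show Matrix.trace (!![0, 1; 0, 0] : Matrix (Fin 2) (Fin 2) ℂ) = 0 by
    simp [Matrix.trace_fin_two]⟩

/-- The lowering generator `Y` of `sl(2)`. -/
def eY : SL2 :=
  ⟨!![0, 0; 1, 0], show Matrix.trace (!![0, 0; 1, 0] : Matrix (Fin 2) (Fin 2) ℂ) = 0 by
    simp [Matrix.trace_fin_two]⟩

/-- The Cartan generator `H` of `sl(2)`. -/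
def eH : SL2 :=
  ⟨!![1, 0; 0, -1], show Matrix.trace (!![1, 0; 0, -1] : Matrix (Fin 2) (Fin 2) ℂ) = 0 by
    simp [Matrix.trace_fin_two]⟩

lemma isSl2Triple : IsSl2Triple eH eX eY where
  h_ne_zero h := by simpa [eH] using congrFun (congrFun (congrArg Subtype.val h) 0) 0
  lie_e_f := Subtype.ext <| by
    rw [LieAlgebra.SpecialLinear.sl_bracket]
    ext i j; fin_cases i <;> fin_cases j <;> simp [eX, eY, eH]
  lie_h_e_nsmul := Subtype.ext <| by
    rw [LieAlgebra.SpecialLinear.sl_bracket]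
    ext i j; fin_cases i <;> fin_cases j <;> (simp [eX, eH]; try norm_num)
  lie_h_f_nsmul := Subtype.ext <| by
    rw [LieAlgebra.SpecialLinear.sl_bracket]
    ext i j; fin_cases i <;> fin_cases j <;> (simp [eY, eH]; try norm_num)

lemma sl2_eq (B : SL2) : B = B.1 0 0 • eH + B.1 0 1 • eX + B.1 1 0 • eY := by
  refine Subtype.ext ?_
  ext i j
  fin_cases i <;> fin_cases j <;> simp [eX, eY, eH, sl2_apply_one_one]

/-! ### Weight spaces and lowest weight vectors -/

section Weights

variable (V : Type*) [AddCommGroup V] [Module ℂ V] [LieRingModule SL2 V] [LieModule ℂ SL2 V]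

/-- The space of vectors of weight `μ`: the eigenspace of `H` for the eigenvalue `μ`. -/
def weightH (μ : ℂ) : Submodule ℂ V := End.eigenspace (toEnd ℂ SL2 V eH) μ

/-- The space of lowest weight vectors of weight `μ`: the vectors of weight `μ` that are killed
by `Y`. -/
def lowest (μ : ℂ) : Submodule ℂ V := weightH V μ ⊓ LinearMap.ker (toEnd ℂ SL2 V eY)

/-- The action of `X` as a linear operator. -/
abbrev raise : End ℂ V := toEnd ℂ SL2 V eX

variable {V} {μ : ℂ} {v : V}

lemma mem_weightH : v ∈ weightH V μ ↔ ⁅eH, v⁆ = μ • v := End.mem_eigenspace_iff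

lemma mem_lowest : v ∈ lowest V μ ↔ ⁅eH, v⁆ = μ • v ∧ ⁅eY, v⁆ = 0 :=
  and_congr mem_weightH Iff.rfl

lemma lie_eX_mem (h : v ∈ weightH V μ) : ⁅eX, v⁆ ∈ weightH V (μ + 2) := by
  rw [mem_weightH] at h ⊢
  rw [leibniz_lie, isSl2Triple.lie_h_e_smul ℂ, h, lie_smul, smul_lie]
  module

lemma lie_eY_mem (h : v ∈ weightH V μ) : ⁅eY, v⁆ ∈ weightH V (μ - 2) := by
  rw [mem_weightH] at h ⊢
  rw [leibniz_lie, isSl2Triple.lie_lie_smul_f ℂ, h, lie_smul, neg_lie, smul_lie]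
  module

lemma raise_pow_mem (h : v ∈ weightH V μ) (k : ℕ) : (raise V ^ k) v ∈ weightH V (μ + 2 * k) := by
  induction k with
  | zero => simpa using h
  | succ k ih =>
    rw [pow_succ', Module.End.mul_apply]
    have := lie_eX_mem ih
    rwa [show μ + 2 * (k : ℂ) + 2 = μ + 2 * ((k + 1 : ℕ) : ℂ) by push_cast; ring] at this

lemma lie_eX_raise_pow (k : ℕ) (v : V) : ⁅eX, (raise V ^ k) v⁆ = (raise V ^ (k + 1)) v := by
  rw [pow_succ', Module.End.mul_apply, toEnd_apply_apply]

lemma lie_eY_raise_pow_succ (h : v ∈ lowest V μ) (k : ℕ) :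
    ⁅eY, (raise V ^ (k + 1)) v⁆ = (-((k + 1) * (μ + k))) • (raise V ^ k) v := by
  rw [mem_lowest] at h
  by_cases hv : v = 0
  · simp [hv]
  have P : isSl2Triple.symm.HasPrimitiveVectorWith v (-μ) :=
    ⟨hv, by rw [neg_lie, h.1, neg_smul], h.2⟩
  have := P.lie_e_pow_succ_toEnd_f k
  rw [this]
  congr 1
  ring

/-- On the span of `X ^ k v`, `v` of lowest weight `μ`, the Casimir operator is the
scalar `μ² - 2μ`. -/
lemma casimir_raise_pow (h : v ∈ lowest V μ) (k : ℕ) :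
    ⁅eH, ⁅eH, (raise V ^ k) v⁆⁆ - (2 : ℂ) • ⁅eH, (raise V ^ k) v⁆
      + (4 : ℂ) • ⁅eX, ⁅eY, (raise V ^ k) v⁆⁆ = (μ ^ 2 - 2 * μ) • (raise V ^ k) v := by
  have hH := mem_weightH.1 (raise_pow_mem h.1 k)
  rw [hH, lie_smul, hH]
  rcases k with _ | k
  · rw [pow_zero, Module.End.one_apply, (mem_lowest.1 h).2]
    simp only [lie_zero, Nat.cast_zero]
    module
  · rw [lie_eY_raise_pow_succ h, lie_smul, lie_eX_raise_pow]
    push_cast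
    module

lemma lowering_coeff_ne_zero (hμ : 0 < μ.re) (k : ℕ) : -(((k : ℂ) + 1) * (μ + k)) ≠ 0 := by
  rw [neg_ne_zero]
  refine mul_ne_zero (by exact_mod_cast k.succ_ne_zero) fun h => ?_
  have := congrArg Complex.re h
  simp only [Complex.add_re, Complex.natCast_re, Complex.zero_re] at this
  have : (0 : ℝ) ≤ k := k.cast_nonneg
  linarith

lemma eq_zero_of_raise_pow_eq_zero (hμ : 0 < μ.re) (h : v ∈ lowest V μ) (k : ℕ)
    (hk : (raise V ^ k) v = 0) : v = 0 := by
  induction k with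
  | zero => simpa using hk
  | succ k ih =>
    have := lie_eY_raise_pow_succ h k
    rw [hk, lie_zero, eq_comm, smul_eq_zero] at this
    exact ih (this.resolve_left (lowering_coeff_ne_zero hμ k))

end Weights

/-! ### Homomorphisms from Verma modules -/

namespace Verma

lemma lie_def (lam : ℂ) (B : SL2) (v : Verma lam) :
    ⁅B, v⁆ = B.1 0 0 • opH lam v + B.1 0 1 • opX lam v + B.1 1 0 • opY lam v := rfl

lemma lie_eX_vec (lam : ℂ) (n : ℕ) : ⁅eX, vec lam n⁆ = vec lam (n + 1) := by
  simp [lie_def, eX, opX, lift_vec]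

lemma lie_eH_vec (lam : ℂ) (n : ℕ) : ⁅eH, vec lam n⁆ = (lam + 2 * n) • vec lam n := by
  simp [lie_def, eH, opH, lift_vec]

lemma lie_eY_vec (lam : ℂ) (n : ℕ) :
    ⁅eY, vec lam n⁆ = (-((n : ℂ) * (lam + n - 1))) • vec lam (n - 1) := by
  simp only [lie_def, eY, opY, lift_vec, Matrix.of_apply, Matrix.cons_val', Matrix.cons_val_zero,
    Matrix.cons_val_one, zero_smul, one_smul, zero_add, Matrix.cons_val_fin_one]

/-- The basis `X ^ n v` of the Verma module. -/
def basis (lam : ℂ) : Basis ℕ ℂ (Verma lam) := Basis.ofRepr (LinearEquiv.refl ℂ (ℕ →₀ ℂ))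

@[simp] lemma basis_apply (lam : ℂ) (n : ℕ) : basis lam n = vec lam n := rfl

lemma vec_zero_mem_lowest (lam : ℂ) : vec lam 0 ∈ lowest (Verma lam) lam := by
  rw [mem_lowest, lie_eH_vec, lie_eY_vec]
  simp

lemma raise_pow_vec_zero (lam : ℂ) (n : ℕ) : (raise (Verma lam) ^ n) (vec lam 0) = vec lam n := by
  induction n with
  | zero => simp
  | succ n ih => rw [← lie_eX_raise_pow, ih, lie_eX_vec]

variable {V : Type*} [AddCommGroup V] [Module ℂ V] [LieRingModule SL2 V] [LieModule ℂ SL2 V]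

lemma hom_raise_pow {lam : ℂ} (φ : Verma lam →ₗ⁅ℂ, SL2⁆ V) (n : ℕ) (v : Verma lam) :
    φ ((raise (Verma lam) ^ n) v) = (raise V ^ n) (φ v) := by
  induction n with
  | zero => simp
  | succ n ih => rw [← lie_eX_raise_pow, LieModuleHom.map_lie, ih, lie_eX_raise_pow]

lemma hom_vec {lam : ℂ} (φ : Verma lam →ₗ⁅ℂ, SL2⁆ V) (n : ℕ) :
    φ (vec lam n) = (raise V ^ n) (φ (vec lam 0)) := by
  rw [← hom_raise_pow, raise_pow_vec_zero]

lemma hom_vec_zero_mem {lam : ℂ} (φ : Verma lam →ₗ⁅ℂ, SL2⁆ V) : φ (vec lam 0) ∈ lowest V lam := by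
  have h := mem_lowest.1 (vec_zero_mem_lowest lam)
  rw [mem_lowest, ← LieModuleHom.map_lie, ← LieModuleHom.map_lie, h.1, h.2]
  simp

/-- The homomorphism from the Verma module that sends `X ^ n v` to `X ^ n w`, where `w` is a
lowest weight vector. -/
def homOfLowest {lam : ℂ} (w : lowest V lam) : Verma lam →ₗ⁅ℂ, SL2⁆ V where
  toLinearMap := (basis lam).constr ℂ fun n => (raise V ^ n) w.1
  map_lie' {B v} := by
    set φ := (basis lam).constr ℂ fun n => (raise V ^ n) w.1 with hφ
    have hv : ∀ n, φ (vec lam n) = (raise V ^ n) w.1 := fun n => by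
      rw [hφ, ← basis_apply, Basis.constr_basis]
    suffices φ ∘ₗ toEnd ℂ SL2 (Verma lam) B = toEnd ℂ SL2 V B ∘ₗ φ from LinearMap.congr_fun this v
    refine (basis lam).ext fun n => ?_
    rw [basis_apply, LinearMap.comp_apply, LinearMap.comp_apply, toEnd_apply_apply,
      toEnd_apply_apply, hv, sl2_eq B]
    simp only [add_lie, smul_lie, map_add, map_smul, lie_eX_vec, lie_eH_vec, hv,
      mem_weightH.1 (raise_pow_mem w.2.1 n), lie_eX_raise_pow]
    congr 2
    rw [lie_eY_vec, map_smul, hv]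
    rcases n with _ | n
    · simp [(mem_lowest.1 w.2).2]
    · rw [lie_eY_raise_pow_succ w.2, Nat.add_sub_cancel]
      push_cast
      congr 1
      ring

variable (V) in
/-- Homomorphisms from the Verma module of lowest weight `lam` are the same as lowest weight
vectors of weight `lam`. -/
def homEquiv (lam : ℂ) : (Verma lam →ₗ⁅ℂ, SL2⁆ V) ≃ₗ[ℂ] lowest V lam where
  toFun φ := ⟨φ (vec lam 0), hom_vec_zero_mem φ⟩
  map_add' _ _ := rfl
  map_smul' _ _ := rfl
  invFun := homOfLowest
  left_inv φ := by
    refine LieModuleHom.ext (LinearMap.congr_fun (f := (homOfLowest _).toLinearMap)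
      (g := φ.toLinearMap) ((basis lam).ext fun n => ?_))
    change (basis lam).constr ℂ _ (basis lam n) = φ (vec lam n)
    rw [Basis.constr_basis, hom_vec]
  right_inv w := Subtype.ext <| by
    change (basis lam).constr ℂ _ (basis lam 0) = w.1
    rw [Basis.constr_basis, pow_zero, Module.End.one_apply]

lemma repr_lie_eY (lam : ℂ) (v : Verma lam) (k : ℕ) :
    (basis lam).repr ⁅eY, v⁆ k = -((k + 1) * (lam + k)) * (basis lam).repr v (k + 1) := by
  suffices (basis lam).coord k ∘ₗ toEnd ℂ SL2 (Verma lam) eY =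
      (-((k + 1) * (lam + k))) • (basis lam).coord (k + 1) from LinearMap.congr_fun this v
  refine (basis lam).ext fun n => ?_
  rw [LinearMap.comp_apply, toEnd_apply_apply, basis_apply, lie_eY_vec, map_smul,
    LinearMap.smul_apply, ← basis_apply, ← basis_apply, Basis.coord_apply, Basis.coord_apply,
    Basis.repr_self, Basis.repr_self]
  rcases n with _ | n
  · simp
  · rcases eq_or_ne n k with rfl | h
    · simp only [Nat.add_sub_cancel, Finsupp.single_eq_same, smul_eq_mul]
      push_cast
      ring
    · simp [h]

/-- A nonzero submodule contains the lowest weight vector, because `Y` lowers the degree in `X`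
of every vector of positive degree by exactly one; and the lowest weight vector generates the
module. -/
lemma isIrreducible {lam : ℂ} (hlam : 0 < lam.re) : LieModule.IsIrreducible ℂ SL2 (Verma lam) := by
  have : Nontrivial (Verma lam) := (basis lam).repr.toEquiv.nontrivial
  refine LieModule.IsIrreducible.mk fun N hN => ?_
  have key : ∀ n : ℕ, ∀ v ∈ N, v ≠ 0 → (∀ k, n < k → (basis lam).repr v k = 0) →
      vec lam 0 ∈ N := by
    intro n
    induction n with
    | zero =>
      intro v hv hv0 hk
      have hr : (basis lam).repr v = Finsupp.single 0 ((basis lam).repr v 0) := by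
        ext k
        rcases k with _ | k
        · simp
        · simp [hk]
      have hv' : v = (basis lam).repr v 0 • vec lam 0 := by
        conv_lhs => rw [← (basis lam).linearCombination_repr v, hr]
        rw [Finsupp.linearCombination_single, basis_apply]
      have hc : (basis lam).repr v 0 ≠ 0 := fun h => hv0 (by rw [hv', h, zero_smul])
      rw [hv'] at hv
      exact (N.toSubmodule.smul_mem_iff hc).1 hv
    | succ n ih =>
      intro v hv hv0 hk
      by_cases hn : (basis lam).repr v (n + 1) = 0
      · refine ih v hv hv0 fun k hk' => ?_
        rcases (Nat.succ_le_of_lt hk').eq_or_lt with rfl | h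
        · exact hn
        · exact hk k h
      · refine ih ⁅eY, v⁆ (N.lie_mem hv) (fun h => ?_) fun k hk' => ?_
        · have h := (repr_lie_eY lam v n).symm.trans (by rw [h])
          rw [map_zero, Finsupp.zero_apply, mul_eq_zero] at h
          exact h.elim (lowering_coeff_ne_zero hlam n) hn
        · rw [repr_lie_eY, hk _ (by omega), mul_zero]
  obtain ⟨v, hv, hv0⟩ := N.toSubmodule.ne_bot_iff.1 (by simpa using hN)
  have h0 : vec lam 0 ∈ N := by
    refine key (((basis lam).repr v).support.sup id) v hv hv0 fun k hk => ?_
    by_contra h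
    exact absurd (Finset.le_sup (f := id) (Finsupp.mem_support_iff.2 h)) (not_le.2 hk)
  have hn : ∀ n, vec lam n ∈ N := fun n => by
    induction n with
    | zero => exact h0
    | succ n ih =>
      rw [← lie_eX_vec]
      exact N.lie_mem ih
  rw [eq_top_iff]
  intro w _
  rw [← (basis lam).linearCombination_repr w]
  exact N.toSubmodule.sum_mem fun n _ => N.toSubmodule.smul_mem _ (hn n)

end Verma

/-! ### Linear algebra of eigenvectors -/

lemma eq_zero_of_sum_eigenvectors {V ι : Type*} [AddCommGroup V] [Module ℂ V] (T : End ℂ V)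
    {c : ι → ℂ} (hc : Function.Injective c) (s : Finset ι) :
    ∀ x : ι → V, (∀ i ∈ s, T (x i) = c i • x i) → ∑ i ∈ s, x i = 0 → ∀ i ∈ s, x i = 0 := by
  classical
  induction s using Finset.induction_on with
  | empty => simp
  | insert a s ha ih =>
    intro x hx h
    rw [Finset.sum_insert ha] at h
    have hs : ∀ i ∈ s, x i = 0 := by
      intro i hi
      have h1 : ∑ i ∈ s, (c i - c a) • x i = 0 := by
        have h2 := congrArg T h
        rw [map_add, map_sum, map_zero, hx a (Finset.mem_insert_self a s),
          Finset.sum_congr rfl fun i hi => hx i (Finset.mem_insert_of_mem hi),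
          eq_neg_of_add_eq_zero_left h, smul_neg, Finset.smul_sum, neg_add_eq_sub,
          ← Finset.sum_sub_distrib] at h2
        rw [← h2]
        exact Finset.sum_congr rfl fun i _ => sub_smul _ _ _
      have h2 := ih (fun i => (c i - c a) • x i) (fun i hi => by
        rw [map_smul, hx i (Finset.mem_insert_of_mem hi), smul_comm]) h1 i hi
      refine (smul_eq_zero.1 h2).resolve_left fun h3 => ha ?_
      rwa [← hc (sub_eq_zero.1 h3)]
    rw [Finset.sum_eq_zero hs, add_zero] at h
    intro i hi
    rcases Finset.mem_insert.1 hi with rfl | hi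
    · exact h
    · exact hs i hi

lemma finrank_map_add_finrank_inf_ker {V W : Type*} [AddCommGroup V] [Module ℂ V] [AddCommGroup W]
    [Module ℂ W] (T : V →ₗ[ℂ] W) (p : Submodule ℂ V) [FiniteDimensional ℂ p] :
    finrank ℂ (p.map T) + finrank ℂ (p ⊓ LinearMap.ker T : Submodule ℂ V) = finrank ℂ p := by
  rw [← LinearMap.finrank_range_add_finrank_ker (T.domRestrict p), LinearMap.range_domRestrict,
    LinearMap.ker_domRestrict, ← Submodule.finrank_map_subtype_eq p, Submodule.map_comap_subtype]

/-! ### Decomposition into Verma modules -/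

section Decomposition

variable {V : Type*} [AddCommGroup V] [Module ℂ V] [LieRingModule SL2 V] [LieModule ℂ SL2 V]

variable (V) in
/-- The part of the weight space of weight `μ` generated by lowest weight vectors. -/
def generated (μ : ℂ) : Submodule ℂ V := ⨆ k : ℕ, (lowest V (μ - 2 * k)).map (raise V ^ k)

lemma raise_pow_mem_generated {μ : ℂ} {k : ℕ} {w : V} (hw : w ∈ lowest V (μ - 2 * k)) :
    (raise V ^ k) w ∈ generated V μ :=
  Submodule.mem_iSup_of_mem k (Submodule.mem_map_of_mem hw)

lemma generated_le_weightH (μ : ℂ) : generated V μ ≤ weightH V μ := by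
  refine iSup_le fun k => ?_
  rintro _ ⟨w, hw, rfl⟩
  simpa using raise_pow_mem hw.1 k

lemma lowest_le_generated (μ : ℂ) : lowest V μ ≤ generated V μ := fun w hw => by
  have : (raise V ^ 0) w ∈ generated V μ := raise_pow_mem_generated (by simpa using hw)
  simpa using this

/-- All weights have positive real part. -/
def PositiveWeights (V : Type*) [AddCommGroup V] [Module ℂ V] [LieRingModule SL2 V]
    [LieModule ℂ SL2 V] : Prop := ∀ (μ : ℂ) (v : V), v ∈ weightH V μ → v ≠ 0 → 0 < μ.re

/-- `Y` maps `X ^ (k + 1) w` to a nonzero multiple of `X ^ k w`. -/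
lemma PositiveWeights.exists_lie_eY_eq (hV : PositiveWeights V) {μ : ℂ} {u : V}
    (hu : u ∈ generated V (μ - 2)) : ∃ u' ∈ generated V μ, ⁅eY, u'⁆ = u := by
  suffices generated V (μ - 2) ≤ (generated V μ).map (toEnd ℂ SL2 V eY) from this hu
  refine iSup_le fun k => ?_
  rintro _ ⟨w, hw, rfl⟩
  by_cases hw0 : w = 0
  · simp [hw0]
  have hc := lowering_coeff_ne_zero (hV _ w hw.1 hw0) k
  refine ⟨_, Submodule.smul_mem _ (-(((k : ℂ) + 1) * (μ - 2 - 2 * k + k)))⁻¹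
    (raise_pow_mem_generated (k := k + 1) (w := w) ?_), ?_⟩
  · rwa [show μ - 2 * ((k + 1 : ℕ) : ℂ) = μ - 2 - 2 * k by push_cast; ring]
  · rw [map_smul, toEnd_apply_apply, lie_eY_raise_pow_succ hw, smul_smul, inv_mul_cancel₀ hc,
      one_smul]

/-- Since all weights have positive real part, `Y` is locally nilpotent; the claim follows by
induction on the weight, by subtracting from `v` an element of `generated V μ` with the same image
under `Y`. -/
lemma PositiveWeights.weightH_le_generated (hV : PositiveWeights V) (μ : ℂ) :
    weightH V μ ≤ generated V μ := by
  suffices h : ∀ (n : ℕ) (μ : ℂ), μ.re ≤ 2 * n → weightH V μ ≤ generated V μ by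
    obtain ⟨n, hn⟩ := exists_nat_ge μ.re
    exact h n μ (hn.trans (by linarith [n.cast_nonneg (α := ℝ)]))
  intro n
  induction n with
  | zero =>
    intro μ hμ v hv
    by_cases hv0 : v = 0
    · rw [hv0]
      exact zero_mem _
    · have := hV μ v hv hv0
      simp only [Nat.cast_zero, mul_zero] at hμ
      linarith
  | succ n ih =>
    intro μ hμ v hv
    obtain ⟨u, hu, huv⟩ := hV.exists_lie_eY_eq (ih (μ - 2) (by
      push_cast at hμ
      rw [Complex.sub_re, Complex.re_ofNat]
      linarith) (lie_eY_mem hv))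
    have h : v - u ∈ lowest V μ := ⟨sub_mem hv (generated_le_weightH μ hu),
      LinearMap.mem_ker.2 (by rw [toEnd_apply_apply, lie_sub, huv, sub_self])⟩
    rw [← sub_add_cancel v u]
    exact add_mem (lowest_le_generated μ h) hu

lemma PositiveWeights.map_lie_eY_weightH (hV : PositiveWeights V) (μ : ℂ) :
    (weightH V μ).map (toEnd ℂ SL2 V eY) = weightH V (μ - 2) := by
  refine le_antisymm ?_ fun u hu => ?_
  · rintro _ ⟨v, hv, rfl⟩
    exact lie_eY_mem hv
  · obtain ⟨v, hv, h⟩ := hV.exists_lie_eY_eq (hV.weightH_le_generated _ hu)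
    exact ⟨v, generated_le_weightH μ hv, h⟩

lemma PositiveWeights.finrank_lowest (hV : PositiveWeights V) (μ : ℂ)
    [FiniteDimensional ℂ (weightH V μ)] :
    finrank ℂ (weightH V (μ - 2)) + finrank ℂ (lowest V μ) = finrank ℂ (weightH V μ) := by
  rw [← hV.map_lie_eY_weightH]
  exact finrank_map_add_finrank_inf_ker _ _

variable (V) in
/-- The evaluation map `φ ⊗ v ↦ φ v` on `Hom(𝕍_lam, V) ⊗ 𝕍_lam`. -/
def evalHom (lam : ℂ) : (Verma lam →ₗ⁅ℂ, SL2⁆ V) ⊗[ℂ] Verma lam →ₗ[ℂ] V :=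
  TensorProduct.lift
    { toFun := fun φ => φ.toLinearMap
      map_add' := fun _ _ => rfl
      map_smul' := fun _ _ => rfl }

@[simp] lemma evalHom_tmul {lam : ℂ} (φ : Verma lam →ₗ⁅ℂ, SL2⁆ V) (v : Verma lam) :
    evalHom V lam (φ ⊗ₜ v) = φ v := rfl

/-- Homomorphisms from a Verma module are determined by the images of the `X ^ n v`, which have
different weights for different `n`. -/
lemma evalHom_injective {lam : ℂ} (hlam : 0 < lam.re) : Function.Injective (evalHom V lam) := by
  rw [injective_iff_map_eq_zero]
  intro t ht
  obtain ⟨b, rfl⟩ := (TensorProduct.equivFinsuppOfBasisRight (Verma.basis lam)).symm.surjective t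
  rw [TensorProduct.equivFinsuppOfBasisRight_symm_apply, Finsupp.sum, map_sum] at ht
  simp only [evalHom_tmul, Verma.basis_apply] at ht
  have h := eq_zero_of_sum_eigenvectors (toEnd ℂ SL2 V eH) (c := fun n : ℕ => lam + 2 * n)
    (fun i j hij => by simpa using hij) b.support (fun n => b n (Verma.vec lam n)) (fun n _ => by
      rw [toEnd_apply_apply, ← LieModuleHom.map_lie, Verma.lie_eH_vec, map_smul]) ht
  have hb : b = 0 := by
    ext1 n
    by_contra hn
    have h1 := h n (Finsupp.mem_support_iff.2 hn)
    rw [Verma.hom_vec] at h1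
    have h2 := eq_zero_of_raise_pow_eq_zero hlam (Verma.hom_vec_zero_mem (b n)) n h1
    exact hn ((Verma.homEquiv V lam).injective (Subtype.ext (h2.trans rfl)))
  rw [hb, map_zero]

variable (V) in
/-- The Casimir operator `H² - 2H + 4XY`. -/
def casimir : End ℂ V :=
  toEnd ℂ SL2 V eH * toEnd ℂ SL2 V eH - (2 : ℂ) • toEnd ℂ SL2 V eH
    + (4 : ℂ) • (toEnd ℂ SL2 V eX * toEnd ℂ SL2 V eY)

lemma casimir_evalHom {lam : ℂ} (t : (Verma lam →ₗ⁅ℂ, SL2⁆ V) ⊗[ℂ] Verma lam) :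
    casimir V (evalHom V lam t) = (lam ^ 2 - 2 * lam) • evalHom V lam t := by
  suffices casimir V ∘ₗ evalHom V lam = (lam ^ 2 - 2 * lam) • evalHom V lam from
    LinearMap.congr_fun this t
  refine TensorProduct.ext (LinearMap.ext fun φ => (Verma.basis lam).ext fun n => ?_)
  have h := casimir_raise_pow (Verma.hom_vec_zero_mem φ) n
  rw [← Verma.hom_vec] at h
  exact h

variable (V) in
/-- The sum of the evaluation maps for a sequence of lowest weights. -/
def evalSum (lam : ℕ → ℂ) :
    (⨁ n, (Verma (lam n) →ₗ⁅ℂ, SL2⁆ V) ⊗[ℂ] Verma (lam n)) →ₗ[ℂ] V :=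
  DirectSum.toModule ℂ ℕ V fun n => evalHom V (lam n)

lemma evalSum_lof (lam : ℕ → ℂ) (n : ℕ) (t : (Verma (lam n) →ₗ⁅ℂ, SL2⁆ V) ⊗[ℂ] Verma (lam n)) :
    evalSum V lam (DirectSum.lof ℂ ℕ _ n t) = evalHom V (lam n) t :=
  DirectSum.toModule_lof (φ := fun n => evalHom V (lam n)) ℂ n t

/-- The images of the different evaluation maps are independent, because the Casimir operator
acts on them by different scalars. -/
lemma evalSum_injective {lam : ℕ → ℂ} (hlam : ∀ n, 0 < (lam n).re)
    (hcas : Function.Injective fun n => lam n ^ 2 - 2 * lam n) :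
    Function.Injective (evalSum V lam) := by
  classical
  rw [injective_iff_map_eq_zero]
  intro t ht
  rw [← DirectSum.sum_support_of t, map_sum] at ht
  have h := eq_zero_of_sum_eigenvectors (casimir V) hcas (DFinsupp.support t)
    (fun n => evalHom V (lam n) (t n)) (fun n _ => casimir_evalHom _)
    ((Finset.sum_congr rfl fun n _ => (evalSum_lof lam n _).symm).trans ht)
  refine DFinsupp.ext fun n => ?_
  by_contra hn
  exact hn ((injective_iff_map_eq_zero _).1 (evalHom_injective (hlam n)) _
    (h n (DFinsupp.mem_support_iff.2 hn)))

lemma evalSum_surjective {lam : ℕ → ℂ} (hlam : ∀ n, 0 < (lam n).re)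
    (hmem : ∀ (μ : ℂ) (v : V), v ∈ weightH V μ → v ≠ 0 → ∃ n, μ = lam n)
    (htop : ⨆ μ, weightH V μ = ⊤) :
    Function.Surjective (evalSum V lam) := by
  have hV : PositiveWeights V := fun μ v hv hv0 => by
    obtain ⟨n, rfl⟩ := hmem μ v hv hv0
    exact hlam n
  rw [← LinearMap.range_eq_top, eq_top_iff, ← htop]
  refine iSup_le fun μ => (hV.weightH_le_generated μ).trans (iSup_le fun k => ?_)
  rintro _ ⟨w, hw, rfl⟩
  by_cases hw0 : w = 0
  · simp [hw0]
  obtain ⟨n, hn⟩ := hmem _ w hw.1 hw0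
  rw [hn] at hw
  refine ⟨DirectSum.lof ℂ ℕ _ n (Verma.homOfLowest ⟨w, hw⟩ ⊗ₜ Verma.vec (lam n) k), ?_⟩
  rw [evalSum_lof, evalHom_tmul, Verma.hom_vec]
  exact congrArg _ (congrArg Subtype.val ((Verma.homEquiv V (lam n)).right_inv ⟨w, hw⟩))

end Decomposition

/-! ### Weight spaces of polynomials -/

open MvPolynomial

lemma sum_vecVar {M : Type*} [AddCommMonoid M] (f : VecVar → M) :
    ∑ u, f u = f .x + f .y + f .z := by
  change ∑ u ∈ ({.x, .y, .z} : Finset VecVar), f u = _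
  rw [Finset.sum_insert (by decide), Finset.sum_insert (by decide), Finset.sum_singleton, add_assoc]

lemma coeff_X_mul_pderiv {σ : Type*} (d : σ →₀ ℕ) (i : σ) (f : MvPolynomial σ ℂ) :
    coeff d (X i * pderiv i f) = d i * coeff d f := by
  classical
  rw [coeff_X_mul']
  split_ifs with h
  · rw [coeff_pderiv]
    have hd : d - Finsupp.single i 1 + Finsupp.single i 1 = d :=
      tsub_add_cancel_of_le (Finsupp.single_le_iff.2
        (Nat.one_le_iff_ne_zero.2 (Finsupp.mem_support_iff.1 h)))
    rw [hd, mul_comm]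
    congr 1
    conv_rhs => rw [← hd]
    simp
  · simp [Finsupp.notMem_support_iff.1 h]

variable {m : ℕ}

lemma xyWeight_eq (d : Coord m →₀ ℕ) :
    Finsupp.weight (xyWeight m) d = ∑ j, d (.x, j) + ∑ j, d (.y, j) := by
  rw [Finsupp.weight_apply, Finsupp.sum_fintype _ _ (by simp), Fintype.sum_prod_type, sum_vecVar]
  simp [xyWeight]

/-- The weights `-1`, `1`, `1` of `x`, `y`, `z`, for which `𝔼_y - 𝔼_x + 𝔼_z` is the Euler
operator. -/
def eWeight (m : ℕ) : Coord m → ℂ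
  | (.x, _) => -1
  | (.y, _) => 1
  | (.z, _) => 1

lemma eWeight_eq (d : Coord m →₀ ℕ) :
    Finsupp.weight (eWeight m) d =
      ((∑ j, d (.y, j) : ℕ) : ℂ) - (∑ j, d (.x, j) : ℕ) + (∑ j, d (.z, j) : ℕ) := by
  rw [Finsupp.weight_apply, Finsupp.sum_fintype _ _ (by simp), Fintype.sum_prod_type, sum_vecVar]
  simp [eWeight]
  ring

lemma pair_apply (a b : Fin m → End ℂ (SpinorPoly m)) (f : SpinorPoly m) :
    pair a b f = ∑ j, a j (b j f) := by
  simp [pair, LinearMap.sum_apply]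

lemma coeff_opE (d : Coord m →₀ ℕ) (f : SpinorPoly m) :
    coeff d (opE mulC derC f) = (Finsupp.weight (eWeight m) d + m / 2) * coeff d f := by
  simp only [opE, LinearMap.add_apply, LinearMap.sub_apply, pair_apply, mulC_apply, derC_apply,
    coeff_add, coeff_sub, coeff_sum, coeff_X_mul_pderiv, LinearMap.smul_apply, coeff_smul,
    Module.End.one_apply, smul_eq_mul, eWeight_eq, ← Finset.sum_mul]
  push_cast
  ring

variable (m) in
/-- The polynomials that are homogeneous of degree `k` in `(x, y)` and eigenvectors of `ℰ` with
eigenvalue `μ`. -/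
def homogWeight (k : ℕ) (μ : ℂ) : Submodule ℂ (SpinorPoly m) :=
  weightedHomogeneousSubmodule ℂ (xyWeight m) k ⊓ End.eigenspace (opE mulC derC) μ

lemma mem_homogWeight {k : ℕ} {μ : ℂ} {f : SpinorPoly m} :
    f ∈ homogWeight m k μ ↔ IsHomogXY k f ∧ opE mulC derC f = μ • f :=
  and_congr Iff.rfl End.mem_eigenspace_iff

/-- A monomial of degrees `a`, `b`, `c` in `x`, `y`, `z`, where `a + b = k`, has weight
`b - a + c + m/2 = m/2 - k + (2b + c)`. -/
lemma exists_weight_eq {k : ℕ} {μ : ℂ} {f : SpinorPoly m} (hf : f ∈ homogWeight m k μ)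
    (hf0 : f ≠ 0) : ∃ n : ℕ, μ = (m : ℂ) / 2 - k + n := by
  rw [mem_homogWeight] at hf
  obtain ⟨d, hd⟩ := ne_zero_iff.1 hf0
  have h := congrArg (coeff d) hf.2
  rw [coeff_opE, coeff_smul, smul_eq_mul, eWeight_eq] at h
  have h' := mul_right_cancel₀ hd h
  have hk := hf.1 hd
  rw [xyWeight_eq] at hk
  refine ⟨2 * ∑ j, d (.y, j) + ∑ j, d (.z, j), ?_⟩
  rw [← h', ← hk]
  push_cast
  ring

lemma opE_apply_of_lie {T : End ℂ (SpinorPoly m)} {c μ : ℂ} {f : SpinorPoly m}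
    (hT : ⁅opE (mulC (m := m)) derC, T⁆ = c • T) (hf : opE mulC derC f = μ • f) :
    opE mulC derC (T f) = (μ + c) • T f := by
  have h := LinearMap.congr_fun hT f
  rw [Ring.lie_def, LinearMap.sub_apply, Module.End.mul_apply, Module.End.mul_apply, hf, map_smul,
    LinearMap.smul_apply, sub_eq_iff_eq_add] at h
  rw [h]
  module

lemma lie_opE_mulC_x (j : Fin m) :
    ⁅opE (mulC (m := m)) derC, mulC .x j⁆ = (-1 : ℂ) • mulC .x j := by
  refine Eq.trans ?_ (neg_one_smul ℂ (mulC .x j)).symm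
  simp [opE, add_lie, sub_lie, one_lie', (isWeyl m).md_p]

lemma lie_opE_mulC_y (j : Fin m) : ⁅opE (mulC (m := m)) derC, mulC .y j⁆ = (1 : ℂ) • mulC .y j := by
  simp [opE, add_lie, sub_lie, one_lie', (isWeyl m).md_p]

lemma lie_opE_mulC_z (j : Fin m) : ⁅opE (mulC (m := m)) derC, mulC .z j⁆ = (1 : ℂ) • mulC .z j := by
  simp [opE, add_lie, sub_lie, one_lie', (isWeyl m).md_p]

lemma lie_opE_derC_x (j : Fin m) : ⁅opE (mulC (m := m)) derC, derC .x j⁆ = (1 : ℂ) • derC .x j := by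
  simp [opE, add_lie, sub_lie, one_lie', (isWeyl m).md_q]

lemma lie_opE_derC_y (j : Fin m) :
    ⁅opE (mulC (m := m)) derC, derC .y j⁆ = (-1 : ℂ) • derC .y j := by
  refine Eq.trans ?_ (neg_one_smul ℂ (derC .y j)).symm
  simp [opE, add_lie, sub_lie, one_lie', (isWeyl m).md_q]

lemma mulC_x_mem_homogWeight {k : ℕ} {μ : ℂ} {f : SpinorPoly m} (hf : f ∈ homogWeight m k μ)
    (j : Fin m) :
    mulC .x j f ∈ homogWeight m (k + 1) (μ - 1) := by
  rw [mem_homogWeight] at hf ⊢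
  refine ⟨?_, by rw [opE_apply_of_lie (lie_opE_mulC_x j) hf.2, sub_eq_add_neg]⟩
  rw [add_comm]
  exact (isWeightedHomogeneous_X ℂ (xyWeight m) (.x, j)).mul hf.1

lemma mulC_y_mem_homogWeight {k : ℕ} {μ : ℂ} {f : SpinorPoly m} (hf : f ∈ homogWeight m k μ)
    (j : Fin m) :
    mulC .y j f ∈ homogWeight m (k + 1) (μ + 1) := by
  rw [mem_homogWeight] at hf ⊢
  refine ⟨?_, by rw [opE_apply_of_lie (lie_opE_mulC_y j) hf.2]⟩
  rw [add_comm]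
  exact (isWeightedHomogeneous_X ℂ (xyWeight m) (.y, j)).mul hf.1

lemma mulC_z_mem_homogWeight {k : ℕ} {μ : ℂ} {f : SpinorPoly m} (hf : f ∈ homogWeight m k μ)
    (j : Fin m) :
    mulC .z j f ∈ homogWeight m k (μ + 1) := by
  rw [mem_homogWeight] at hf ⊢
  exact ⟨mulC_z_mem j k f hf.1, opE_apply_of_lie (lie_opE_mulC_z j) hf.2⟩

lemma isHomogXY_derC {k : ℕ} {f : SpinorPoly m} (hf : IsHomogXY (k + 1) f) (u : VecVar) (j : Fin m)
    (hu : xyWeight m (u, j) = 1) : IsHomogXY k (derC u j f) :=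
  IsWeightedHomogeneous.pderiv (i := (u, j)) (n' := k) hf (by rw [hu])

lemma derC_x_mem_homogWeight {k : ℕ} {μ : ℂ} {f : SpinorPoly m} (hf : f ∈ homogWeight m (k + 1) μ)
    (j : Fin m) : derC .x j f ∈ homogWeight m k (μ + 1) := by
  rw [mem_homogWeight] at hf ⊢
  exact ⟨isHomogXY_derC hf.1 .x j rfl, opE_apply_of_lie (lie_opE_derC_x j) hf.2⟩

lemma derC_y_mem_homogWeight {k : ℕ} {μ : ℂ} {f : SpinorPoly m} (hf : f ∈ homogWeight m (k + 1) μ)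
    (j : Fin m) : derC .y j f ∈ homogWeight m k (μ - 1) := by
  rw [mem_homogWeight] at hf ⊢
  exact ⟨isHomogXY_derC hf.1 .y j rfl,
    by rw [opE_apply_of_lie (lie_opE_derC_y j) hf.2, sub_eq_add_neg]⟩

lemma derC_xy_eq_zero {f : SpinorPoly m} (hf : IsHomogXY 0 f) {u : VecVar} (j : Fin m)
    (hu : u ≠ .z) : derC u j f = 0 :=
  pderiv_eq_zero hf (u, j) (by cases u <;> simp_all [xyWeight])

lemma derC_mulC (u v : VecVar) (i j : Fin m) (f : SpinorPoly m) :
    derC u i (mulC v j f) = mulC v j (derC u i f) + if u = v ∧ i = j then f else 0 := by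
  have h := LinearMap.congr_fun ((isWeyl m).qp u v i j) f
  rw [Ring.lie_def, LinearMap.sub_apply, Module.End.mul_apply, Module.End.mul_apply,
    sub_eq_iff_eq_add'] at h
  rw [h]
  split_ifs <;> rfl

/-- Polynomials that are linear in `(x, y)` are sums `∑_j x_j A_j(z) + y_j B_j(z)`, where
`A_j` and `B_j` are the partial derivatives with respect to `x_j` and `y_j`. -/
def homogWeightOneEquiv (m : ℕ) (μ : ℂ) : homogWeight m 1 μ ≃ₗ[ℂ]
    (Fin m → homogWeight m 0 (μ + 1)) × (Fin m → homogWeight m 0 (μ - 1)) where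
  toFun f := (fun j => ⟨derC .x j f.1, derC_x_mem_homogWeight f.2 j⟩,
    fun j => ⟨derC .y j f.1, derC_y_mem_homogWeight f.2 j⟩)
  map_add' f g := by ext <;> simp
  map_smul' c f := by ext <;> simp
  invFun A := ⟨∑ j, mulC .x j (A.1 j).1 + ∑ j, mulC .y j (A.2 j).1,
    add_mem (sum_mem fun j _ => by simpa using mulC_x_mem_homogWeight (A.1 j).2 j)
      (sum_mem fun j _ => by simpa using mulC_y_mem_homogWeight (A.2 j).2 j)⟩
  left_inv f := Subtype.ext <| by
    have h := (mem_homogWeight.1 f.2).1.sum_weight_X_mul_pderiv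
    rw [Fintype.sum_prod_type, sum_vecVar] at h
    simpa [xyWeight, mulC_apply, derC_apply] using h
  right_inv A := by
    have hA := fun j => (mem_homogWeight.1 (A.1 j).2).1
    have hB := fun j => (mem_homogWeight.1 (A.2 j).2).1
    refine Prod.ext (funext fun i => Subtype.ext ?_) (funext fun i => Subtype.ext ?_)
    · simp [derC_mulC, derC_xy_eq_zero (hA _), derC_xy_eq_zero (hB _)]
    · simp [derC_mulC, derC_xy_eq_zero (hA _), derC_xy_eq_zero (hB _)]

/-! ### The symplectic Dirac operator -/

lemma dirac_apply (f : SpinorPoly m) : dirac mulC derC f =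
    ∑ j, mulC .z j (derC .y j f) - ∑ j, derC .x j (derC .z j f) := by
  rw [dirac, LinearMap.sub_apply, pair_apply, pair_apply]

lemma dirac_eq_zero {f : SpinorPoly m} (hf : IsHomogXY 0 f) : dirac mulC derC f = 0 := by
  rw [dirac_apply, Finset.sum_eq_zero, Finset.sum_eq_zero, sub_zero]
  · intro j _
    exact derC_xy_eq_zero (derC_z_mem j 0 f hf) j (by simp)
  · intro j _
    rw [derC_xy_eq_zero hf j (by simp), map_zero]

lemma opE_dirac {μ : ℂ} {f : SpinorPoly m} (hf : opE mulC derC f = μ • f) :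
    opE mulC derC (dirac mulC derC f) = μ • dirac mulC derC f := by
  rw [opE_apply_of_lie (c := 0) (by rw [(isWeyl m).lie_opE_dirac, zero_smul]) hf, add_zero]

lemma dirac_mem_homogWeight {μ : ℂ} {f : SpinorPoly m} (hf : f ∈ homogWeight m 1 μ) :
    dirac mulC derC f ∈ homogWeight m 0 μ := by
  rw [mem_homogWeight] at hf ⊢
  refine ⟨?_, opE_dirac hf.2⟩
  rw [dirac_apply]
  refine (weightedHomogeneousSubmodule ℂ (xyWeight m) 0).sub_mem (sum_mem fun j _ => ?_)
    (sum_mem fun j _ => ?_)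
  · exact mulC_z_mem j 0 _ (isHomogXY_derC hf.1 .y j rfl)
  · exact isHomogXY_derC (derC_z_mem j 1 f hf.1) .x j rfl

lemma opE_apply_of_isHomogXY_zero {f : SpinorPoly m} (hf : IsHomogXY 0 f) :
    opE mulC derC f = ∑ j, mulC .z j (derC .z j f) + ((m : ℂ) / 2) • f := by
  simp only [opE, LinearMap.add_apply, LinearMap.sub_apply, pair_apply, LinearMap.smul_apply,
    Module.End.one_apply]
  rw [Finset.sum_eq_zero fun j _ => by rw [derC_xy_eq_zero hf j (by simp), map_zero],
    Finset.sum_eq_zero fun j _ => by rw [derC_xy_eq_zero hf j (by simp), map_zero]]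
  simp

/-- `D_s` is surjective: if `g(z)` is homogeneous of degree `n`, then it maps `⟨x, z⟩ g` to
`-(m + n) g`. -/
lemma map_dirac_homogWeight (hm : m ≠ 0) (μ : ℂ) :
    (homogWeight m 1 μ).map (dirac mulC derC) = homogWeight m 0 μ := by
  refine le_antisymm ?_ fun g hg => ?_
  · rintro _ ⟨f, hf, rfl⟩
    exact dirac_mem_homogWeight hf
  · by_cases hg0 : g = 0
    · rw [hg0]
      exact zero_mem _
    obtain ⟨n, hn⟩ := exists_weight_eq hg hg0
    have hg' := mem_homogWeight.1 hg
    have hz : ∑ j, mulC .z j (derC .z j g) = (n : ℂ) • g := by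
      have h := opE_apply_of_isHomogXY_zero hg'.1
      rw [hg'.2, ← sub_eq_iff_eq_add] at h
      rw [← h, hn]
      push_cast
      module
    have hmn : -((m : ℂ) + n) ≠ 0 := by
      rw [neg_ne_zero]
      exact_mod_cast fun h : m + n = 0 => hm (by omega)
    have hxz : ∑ j, mulC .x j (mulC .z j g) ∈ homogWeight m 1 μ :=
      sum_mem fun j _ => by simpa using mulC_x_mem_homogWeight (mulC_z_mem_homogWeight hg j) j
    refine ⟨(-((m : ℂ) + n))⁻¹ • ∑ j, mulC .x j (mulC .z j g), Submodule.smul_mem _ _ hxz, ?_⟩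
    have hD : dirac mulC derC (∑ j, mulC .x j (mulC .z j g)) = (-((m : ℂ) + n)) • g := by
      have h0 := fun (u : VecVar) (i : Fin m) (hu : u ≠ .z) => derC_xy_eq_zero hg'.1 i hu
      have hxz0 := fun i : Fin m => derC_xy_eq_zero (derC_z_mem i 0 g hg'.1) (u := .x) i (by simp)
      have hx0 : ∀ i j : Fin m, derC .x i (if i = j then g else 0) = 0 := fun i j => by
        split_ifs
        · exact h0 .x i (by simp)
        · exact map_zero _
      rw [dirac_apply]
      simp only [map_sum, derC_mulC, map_add, h0 .y _ (by simp), map_zero]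
      simp only [reduceCtorEq, false_and, if_false, add_zero, true_and, hxz0, hx0, map_zero,
        zero_add, Finset.sum_const_zero, zero_sub, Finset.sum_add_distrib, hz,
        Finset.sum_ite_eq, Finset.mem_univ, if_true, Finset.sum_const, Finset.card_univ,
        Fintype.card_fin, ← Nat.cast_smul_eq_nsmul ℂ]
      module
    rw [map_smul, hD, smul_smul, inv_mul_cancel₀ hmn, one_smul]

/-! ### Weight spaces of symplectic monogenics -/

variable (m) in
/-- The inclusion of the symplectic monogenics into the polynomials, as a linear map. -/
def toPoly (k : ℕ) : Monogenic m k →ₗ[ℂ] SpinorPoly m := (Monogenic m k).toSubmodule.subtype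

lemma lie_zero_apply (B : SL2) (f : SpinorPoly m) :
    ⁅((0, B) : SOSL2 m), f⁆ = B.1 0 0 • opE mulC derC f + B.1 0 1 • opR mulC derC f +
      B.1 1 0 • opL mulC derC f := by
  rw [lie_apply]
  have h : rot mulC derC ((0 : SO m) : Matrix (Fin m) (Fin m) ℂ) = (0 : End ℂ (SpinorPoly m)) := by
    simp [rot]
  simp only [h, zero_add, LinearMap.add_apply, LinearMap.smul_apply]

lemma coe_lie_eH {k : ℕ} (f : Monogenic m k) :
    ((⁅eH, f⁆ : Monogenic m k) : SpinorPoly m) = opE mulC derC f.1 := by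
  rw [sl2_lie_def, LieSubmodule.coe_bracket, lie_zero_apply]
  simp [eH]

lemma coe_lie_eY {k : ℕ} (f : Monogenic m k) :
    ((⁅eY, f⁆ : Monogenic m k) : SpinorPoly m) = opL mulC derC f.1 := by
  rw [sl2_lie_def, LieSubmodule.coe_bracket, lie_zero_apply]
  simp [eY]

lemma mem_weightH_iff {k : ℕ} {μ : ℂ} (f : Monogenic m k) :
    f ∈ weightH (Monogenic m k) μ ↔ f.1 ∈ homogWeight m k μ := by
  rw [mem_weightH, mem_homogWeight, ← coe_lie_eH, Subtype.ext_iff]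
  exact ⟨fun h => ⟨f.2.1, h⟩, fun h => h.2⟩

lemma exists_weight_monogenic {k : ℕ} {μ : ℂ} {f : Monogenic m k}
    (hf : f ∈ weightH (Monogenic m k) μ) (hf0 : f ≠ 0) : ∃ n : ℕ, μ = (m : ℂ) / 2 - k + n :=
  exists_weight_eq ((mem_weightH_iff f).1 hf) fun h => hf0 (Subtype.ext h)

lemma positiveWeights_monogenic {k : ℕ} (hk : 2 * k < m) : PositiveWeights (Monogenic m k) := by
  intro μ f hf hf0
  obtain ⟨n, rfl⟩ := exists_weight_monogenic hf hf0
  have h1 : (2 * k : ℝ) < m := by exact_mod_cast hk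
  have h2 : (0 : ℝ) ≤ n := n.cast_nonneg
  simp only [Complex.add_re, Complex.sub_re, Complex.div_ofNat_re, Complex.natCast_re]
  linarith

/-- A polynomial is the sum of its components that are eigenvectors of `ℰ`, and the components of
a symplectic monogenic are symplectic monogenic, because `D_s` commutes with `ℰ`. -/
lemma iSup_weightH_monogenic (k : ℕ) : ⨆ μ, weightH (Monogenic m k) μ = ⊤ := by
  classical
  rw [eq_top_iff]
  intro f _
  let comp : ℂ → SpinorPoly m := fun c => weightedHomogeneousComponent (eWeight m) c f.1
  let S : Finset ℂ := f.1.support.image (Finsupp.weight (eWeight m))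
  have hcoeff : ∀ c d, coeff d (comp c) =
      if Finsupp.weight (eWeight m) d = c then coeff d f.1 else 0 := fun c d =>
    coeff_weightedHomogeneousComponent (w := eWeight m) c f.1 d
  have hsum : ∑ c ∈ S, comp c = f.1 := by
    ext d
    rw [coeff_sum]
    simp only [hcoeff]
    rw [Finset.sum_ite_eq]
    split_ifs with h
    · rfl
    · by_contra h0
      exact h (Finset.mem_image_of_mem _ (mem_support_iff.2 (Ne.symm h0)))
  -- `ℰ` acts on the component of degree `c` by `c + m/2`
  have hE : ∀ c, opE mulC derC (comp c) = (c + m / 2) • comp c := fun c => by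
    ext d
    rw [coeff_opE, coeff_smul, hcoeff, smul_eq_mul]
    split_ifs with h
    · rw [h]
    · simp
  -- the `D_s (comp c)` are eigenvectors of `ℰ` with different eigenvalues, and their sum is `D_s f`
  have hD := eq_zero_of_sum_eigenvectors (opE mulC derC)
    (add_left_injective ((m : ℂ) / 2)) S (fun c => dirac mulC derC (comp c))
    (fun c _ => opE_dirac (hE c)) (by rw [← map_sum, hsum, f.2.2])
  have hH : ∀ c, IsHomogXY k (comp c) := fun c d hd => by
    rw [hcoeff] at hd
    exact f.2.1 fun h => hd (by rw [h, ite_self])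
  have hf : f = ∑ c ∈ S.attach, (⟨comp c.1, hH c.1, hD c.1 c.2⟩ : Monogenic m k) := by
    refine Subtype.ext (Eq.trans ?_ (map_sum (toPoly m k) (fun c : S =>
      (⟨comp c.1, hH c.1, hD c.1 c.2⟩ : Monogenic m k)) S.attach).symm)
    rw [← hsum, ← Finset.sum_attach]
    rfl
  rw [hf]
  refine sum_mem fun c _ => Submodule.mem_iSup_of_mem (c.1 + (m : ℂ) / 2) ?_
  rw [mem_weightH_iff, mem_homogWeight]
  exact ⟨hH c.1, hE c.1⟩

lemma map_toPoly_weightH (k : ℕ) (μ : ℂ) :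
    (weightH (Monogenic m k) μ).map (toPoly m k) =
      homogWeight m k μ ⊓ LinearMap.ker (dirac mulC derC) := by
  ext f
  constructor
  · rintro ⟨g, hg, rfl⟩
    exact ⟨(mem_weightH_iff g).1 hg, g.2.2⟩
  · rintro ⟨h1, h2⟩
    exact ⟨⟨f, h1.1, h2⟩, (mem_weightH_iff _).2 h1, rfl⟩

lemma finrank_map_toPoly {k : ℕ} (p : Submodule ℂ (Monogenic m k)) :
    finrank ℂ (p.map (toPoly m k)) = finrank ℂ p :=
  (Submodule.equivMapOfInjective (toPoly m k) Subtype.val_injective p).finrank_eq.symm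

/-! ### Harmonic polynomials -/

/-- Polynomials in `z`, as polynomials in `(x, y; z)`. -/
def zIncl (m : ℕ) : MvPolynomial (Fin m) ℂ →ₐ[ℂ] SpinorPoly m := rename fun j => (VecVar.z, j)

lemma zIncl_injective (m : ℕ) : Function.Injective (zIncl m) :=
  rename_injective _ (Prod.mk_right_injective _)

lemma derC_zIncl (j : Fin m) (g : MvPolynomial (Fin m) ℂ) :
    derC .z j (zIncl m g) = zIncl m (pderiv j g) :=
  pderiv_rename (Prod.mk_right_injective _) j g

lemma isHomogXY_zIncl (g : MvPolynomial (Fin m) ℂ) : IsHomogXY 0 (zIncl m g) := by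
  induction g using MvPolynomial.induction_on with
  | C a =>
    rw [zIncl, rename_C]
    exact isWeightedHomogeneous_C _ a
  | add f g hf hg =>
    rw [map_add]
    exact hf.add hg
  | mul_X g j hg =>
    rw [map_mul, mul_comm, zIncl, rename_X]
    exact mulC_z_mem j 0 _ hg

lemma exists_zIncl_eq {f : SpinorPoly m} (hf : IsHomogXY 0 f) : ∃ g, zIncl m g = f := by
  refine exists_rename_eq_of_vars_subset_range f _ (Prod.mk_right_injective _) fun v hv => ?_
  obtain ⟨d, hd, hdv⟩ := (mem_vars_iff_mem_support v).1 hv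
  have h0 := hf (mem_support_iff.1 hd)
  have h : xyWeight m v = 0 := by
    by_contra h
    have := Finsupp.le_weight (xyWeight m) h d
    rw [h0] at this
    exact Finsupp.mem_support_iff.1 hdv (by omega)
  obtain ⟨u, j⟩ := v
  cases u
  · simp [xyWeight] at h
  · simp [xyWeight] at h
  · exact ⟨j, rfl⟩

lemma opE_zIncl (g : MvPolynomial (Fin m) ℂ) :
    opE mulC derC (zIncl m g) =
      zIncl m (∑ j, X j * pderiv j g) + ((m : ℂ) / 2) • zIncl m g := by
  rw [opE_apply_of_isHomogXY_zero (isHomogXY_zIncl g), map_sum]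
  congr 1
  refine Finset.sum_congr rfl fun j _ => ?_
  rw [derC_zIncl, map_mul, mulC_apply]
  exact congrArg (· * _) (rename_X _ j).symm

lemma isHomogeneous_iff_euler (a : ℕ) (g : MvPolynomial (Fin m) ℂ) :
    g.IsHomogeneous a ↔ ∑ j, X j * pderiv j g = (a : ℂ) • g := by
  constructor
  · intro h
    rw [h.sum_X_mul_pderiv, Nat.cast_smul_eq_nsmul]
  · intro h d hd
    have h' := congrArg (coeff d) h
    simp only [coeff_sum, coeff_X_mul_pderiv, coeff_smul, smul_eq_mul, ← Finset.sum_mul] at h'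
    have h'' := mul_right_cancel₀ hd h'
    rw [Finsupp.weight_apply, Finsupp.sum_fintype _ _ (by simp)]
    simpa using (by exact_mod_cast h'' : ∑ j, d j = a)

lemma zIncl_mem_homogWeight (a : ℕ) (g : MvPolynomial (Fin m) ℂ) :
    zIncl m g ∈ homogWeight m 0 ((m : ℂ) / 2 + a) ↔ g.IsHomogeneous a := by
  rw [mem_homogWeight, and_iff_right (isHomogXY_zIncl g), opE_zIncl, isHomogeneous_iff_euler,
    add_smul, add_comm (((m : ℂ) / 2) • zIncl m g), add_left_inj, ← map_smul,
    (zIncl_injective m).eq_iff]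

lemma homogWeight_zero_eq (a : ℕ) : homogWeight m 0 ((m : ℂ) / 2 + a) =
    (homogeneousSubmodule (Fin m) ℂ a).map (zIncl m).toLinearMap := by
  ext f
  constructor
  · intro hf
    obtain ⟨g, rfl⟩ := exists_zIncl_eq (mem_homogWeight.1 hf).1
    exact ⟨g, (zIncl_mem_homogWeight a g).1 hf, rfl⟩
  · rintro ⟨g, hg, rfl⟩
    exact (zIncl_mem_homogWeight a g).2 hg

lemma opL_zIncl (g : MvPolynomial (Fin m) ℂ) :
    opL mulC derC (zIncl m g) = (-(1 / 2) : ℂ) • zIncl m (laplace m g) := by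
  have h : ∀ j : Fin m, derC .y j (zIncl m g) = 0 := fun j =>
    derC_xy_eq_zero (isHomogXY_zIncl g) j (by simp)
  rw [opL, LinearMap.sub_apply, LinearMap.smul_apply, pair_apply, pair_apply]
  simp only [h, map_zero, Finset.sum_const_zero, zero_sub, derC_zIncl, neg_smul]
  simp [laplace, LinearMap.sum_apply]

/-- The lowest weight vectors of the space of polynomials in `z` are the harmonic polynomials. -/
lemma map_toPoly_lowest_zero (a : ℕ) : (lowest (Monogenic m 0) ((m : ℂ) / 2 + a)).map
    (toPoly m 0) =
      (harmonics m a).map (zIncl m).toLinearMap := by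
  have hL : ∀ g, opL mulC derC (zIncl m g) = 0 ↔ laplace m g = 0 := fun g => by
    rw [opL_zIncl, smul_eq_zero, or_iff_right (by norm_num), map_eq_zero_iff _ (zIncl_injective m)]
  ext f
  constructor
  · rintro ⟨f, hf, rfl⟩
    obtain ⟨g, hg⟩ := exists_zIncl_eq f.2.1
    have h1 := (mem_weightH_iff f).1 hf.1
    have h2 : opL mulC derC f.1 = 0 := by
      rw [← coe_lie_eY, (mem_lowest.1 hf).2]
      rfl
    rw [← hg] at h1 h2
    exact ⟨g, ⟨(zIncl_mem_homogWeight a g).1 h1, (hL g).1 h2⟩, hg⟩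
  · rintro ⟨g, ⟨hg1, hg2⟩, rfl⟩
    have h := isHomogXY_zIncl g
    refine ⟨⟨zIncl m g, h, dirac_eq_zero h⟩, ⟨?_, ?_⟩, rfl⟩
    · exact (mem_weightH_iff _).2 ((zIncl_mem_homogWeight a g).2 hg1)
    · exact Subtype.ext ((coe_lie_eY _).trans ((hL g).2 hg2))

/-! ### Dimensions -/

/-- The weights that occur on polynomials in `z` are `m/2 + a`, `a ∈ ℕ`, and the weight space is
then the space of `a`-homogeneous polynomials. -/
instance finite_homogWeight_zero (μ : ℂ) : FiniteDimensional ℂ (homogWeight m 0 μ) := by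
  by_cases h : ∃ a : ℕ, μ = (m : ℂ) / 2 + a
  · obtain ⟨a, rfl⟩ := h
    have : FiniteDimensional ℂ (homogeneousSubmodule (Fin m) ℂ a) :=
      Module.Finite.iff_fg.2 (homogeneousSubmodule_fg (Fin m) ℂ a)
    rw [homogWeight_zero_eq]
    infer_instance
  · have : homogWeight m 0 μ = ⊥ := by
      rw [Submodule.eq_bot_iff]
      intro f hf
      by_contra hf0
      obtain ⟨a, ha⟩ := exists_weight_eq hf hf0
      exact h ⟨a, by simpa using ha⟩
    rw [this]
    infer_instance

instance finite_homogWeight_one (μ : ℂ) : FiniteDimensional ℂ (homogWeight m 1 μ) :=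
  Module.Finite.equiv (homogWeightOneEquiv m μ).symm

lemma finrank_homogWeight_one (μ : ℂ) : finrank ℂ (homogWeight m 1 μ) =
    m * (finrank ℂ (homogWeight m 0 (μ + 1)) + finrank ℂ (homogWeight m 0 (μ - 1))) := by
  rw [(homogWeightOneEquiv m μ).finrank_eq, finrank_prod, finrank_pi_fintype, finrank_pi_fintype]
  simp [mul_add]

lemma finrank_weightH_zero (μ : ℂ) :
    finrank ℂ (weightH (Monogenic m 0) μ) = finrank ℂ (homogWeight m 0 μ) := by
  rw [← finrank_map_toPoly, map_toPoly_weightH,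
    inf_eq_left.2 fun f hf => dirac_eq_zero (mem_homogWeight.1 hf).1]

lemma finrank_weightH_one (hm : m ≠ 0) (μ : ℂ) :
    finrank ℂ (homogWeight m 0 μ) + finrank ℂ (weightH (Monogenic m 1) μ) =
      finrank ℂ (homogWeight m 1 μ) := by
  rw [← finrank_map_toPoly, map_toPoly_weightH,
    ← finrank_map_add_finrank_inf_ker (dirac mulC derC) (homogWeight m 1 μ),
    map_dirac_homogWeight hm]

lemma finite_weightH {k : ℕ} {μ : ℂ} [FiniteDimensional ℂ (homogWeight m k μ)] :
    FiniteDimensional ℂ (weightH (Monogenic m k) μ) := by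
  have : FiniteDimensional ℂ
      (homogWeight m k μ ⊓ LinearMap.ker (dirac mulC derC) : Submodule ℂ (SpinorPoly m)) :=
    Submodule.finiteDimensional_inf_left _ _
  rw [← map_toPoly_weightH] at this
  exact Module.Finite.equiv
    (Submodule.equivMapOfInjective (toPoly m k) Subtype.val_injective (weightH _ μ)).symm

instance finite_weightH_zero (μ : ℂ) : FiniteDimensional ℂ (weightH (Monogenic m 0) μ) :=
  finite_weightH

instance finite_weightH_one (μ : ℂ) : FiniteDimensional ℂ (weightH (Monogenic m 1) μ) :=
  finite_weightH

lemma finrank_lowest_zero (a : ℕ) :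
    finrank ℂ (lowest (Monogenic m 0) ((m : ℂ) / 2 + a)) = finrank ℂ (harmonics m a) := by
  rw [← finrank_map_toPoly, map_toPoly_lowest_zero]
  exact (Submodule.equivMapOfInjective (zIncl m).toLinearMap (zIncl_injective m) _).finrank_eq.symm

lemma finrank_lowest_zero_of_lt {μ : ℂ} (hμ : μ.re < (m : ℝ) / 2) :
    finrank ℂ (lowest (Monogenic m 0) μ) = 0 := by
  suffices h : lowest (Monogenic m 0) μ = ⊥ by rw [h, finrank_bot]
  rw [Submodule.eq_bot_iff]
  intro f hf
  by_contra hf0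
  obtain ⟨n, rfl⟩ := exists_weight_monogenic hf.1 hf0
  have : (0 : ℝ) ≤ n := n.cast_nonneg
  simp at hμ
  linarith

/-- The multiplicity of a Verma module in `𝕊_1^∞`. Linear polynomials in `(x, y)` are `2m` copies of
the polynomials in `z`, with weights shifted by `-1` and `1`, and `D_s` maps onto the polynomials
in `z`. -/
lemma finrank_lowest_one (hm : 3 ≤ m) (μ : ℂ) :
    (finrank ℂ (lowest (Monogenic m 1) μ) : ℤ) =
      m * (finrank ℂ (lowest (Monogenic m 0) (μ - 1)) + finrank ℂ (lowest (Monogenic m 0) (μ + 1)))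
        - finrank ℂ (lowest (Monogenic m 0) μ) := by
  have hp0 : PositiveWeights (Monogenic m 0) := positiveWeights_monogenic (by omega)
  have hp1 : PositiveWeights (Monogenic m 1) := positiveWeights_monogenic (by omega)
  have h0 := fun ν : ℂ => hp0.finrank_lowest ν
  simp only [finrank_weightH_zero] at h0
  have h1 := hp1.finrank_lowest μ
  have h2 := fun ν : ℂ => finrank_weightH_one (m := m) (by omega) ν
  simp only [finrank_homogWeight_one] at h2
  -- `a1`, `a2`, `a3` express `h(μ ± 1)` and `h(μ)` by dimensions of weight spaces on polynomials in
  -- `z`, and `b1`, `b2` do the same for the weight spaces of weights `μ` and `μ - 2` on `𝕊_1^∞`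
  have a1 := h0 (μ - 1)
  have a2 := h0 (μ + 1)
  have a3 := h0 μ
  have b1 := h2 μ
  have b2 := h2 (μ - 2)
  rw [show μ - 2 + 1 = μ - 1 by ring, show μ - 2 - 1 = μ - 1 - 2 by ring] at b2
  rw [show μ + 1 - 2 = μ - 1 by ring] at a2
  zify at a1 a2 a3 b1 b2 h1
  linear_combination h1 + b1 - b2 - (m : ℤ) * a1 - (m : ℤ) * a2 + a3

lemma finrank_harmonics_zero (m : ℕ) : finrank ℂ (harmonics m 0) = 1 := by
  have h : harmonics m 0 = ℂ ∙ (1 : MvPolynomial (Fin m) ℂ) := by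
    rw [harmonics, inf_eq_left.2, homogeneousSubmodule_zero, Submodule.one_eq_span]
    intro f hf
    rw [homogeneousSubmodule_zero, Submodule.mem_one] at hf
    obtain ⟨c, rfl⟩ := hf
    simp [laplace, LinearMap.sum_apply]
  rw [h, finrank_span_singleton one_ne_zero]

lemma finrank_harmonics_one (m : ℕ) : finrank ℂ (harmonics m 1) = m := by
  classical
  have h : harmonics m 1 = Submodule.span ℂ (Set.range X) := by
    rw [harmonics, inf_eq_left.2, homogeneousSubmodule_one_eq_span_X]
    rw [homogeneousSubmodule_one_eq_span_X, Submodule.span_le]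
    rintro _ ⟨j, rfl⟩
    simp [laplace, LinearMap.sum_apply, pderiv_X, Pi.single_apply, apply_ite]
  rw [h, finrank_span_eq_card (linearIndependent_X (Fin m) ℂ), Fintype.card_fin]

/-! ### The decomposition of `𝕊_1^∞` -/

lemma evalHom_lie {m k : ℕ} {lam : ℂ} (g : SOSL2 m) (φ : MultSpace m k lam) (v : Verma lam) :
    evalHom (Monogenic m k) lam ⁅g, φ ⊗ₜ[ℂ] v⁆ = ⁅g, φ v⁆ := by
  rw [TensorProduct.LieModule.lie_tmul_right, map_add, evalHom_tmul, evalHom_tmul]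
  change ⁅((g.1, 0) : SOSL2 m), φ v⁆ + φ ⁅g.2, v⁆ = _
  rw [LieModuleHom.map_lie, sl2_lie_def, ← add_lie, Prod.mk_add_mk, add_zero, zero_add]

/-- The sum of the evaluation maps, as a homomorphism of modules over `so(m) × sl(2)`. -/
def evalSumLie (m k : ℕ) (lam : ℕ → ℂ) :
    (⨁ n, MultSpace m k (lam n) ⊗[ℂ] Verma (lam n)) →ₗ⁅ℂ, SOSL2 m⁆ Monogenic m k where
  toLinearMap := evalSum (Monogenic m k) lam
  map_lie' {g t} := by
    suffices evalSum (Monogenic m k) lam ∘ₗ toEnd ℂ (SOSL2 m) _ g =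
        toEnd ℂ (SOSL2 m) (Monogenic m k) g ∘ₗ evalSum (Monogenic m k) lam from
      LinearMap.congr_fun this t
    refine DirectSum.linearMap_ext ℂ fun n => TensorProduct.ext' fun φ v => ?_
    have h : ⁅g, DirectSum.lof ℂ ℕ (fun n => MultSpace m k (lam n) ⊗[ℂ] Verma (lam n)) n (φ ⊗ₜ v)⁆ =
        DirectSum.lof ℂ ℕ (fun n => MultSpace m k (lam n) ⊗[ℂ] Verma (lam n)) n ⁅g, φ ⊗ₜ[ℂ] v⁆ :=
      ((DirectSum.lieModuleOf ℂ ℕ (SOSL2 m)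
        (fun n => MultSpace m k (lam n) ⊗[ℂ] Verma (lam n)) n).map_lie g (φ ⊗ₜ v)).symm
    simp only [LinearMap.comp_apply, toEnd_apply_apply]
    rw [h, evalSum_lof, evalSum_lof, evalHom_lie, evalHom_tmul]

lemma evalSumLie_bijective (hm : 4 ≤ m) :
    Function.Bijective (evalSumLie m 1 fun n => (m : ℂ) / 2 - 1 + n) := by
  have hre : ∀ n : ℕ, 1 ≤ ((m : ℂ) / 2 - 1 + n).re := fun n => by
    have h1 : (4 : ℝ) ≤ m := by exact_mod_cast hm
    have h2 : (0 : ℝ) ≤ n := n.cast_nonneg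
    simp only [Complex.add_re, Complex.sub_re, Complex.div_ofNat_re, Complex.natCast_re,
      Complex.one_re]
    linarith
  refine ⟨evalSum_injective (fun n => zero_lt_one.trans_le (hre n)) fun a b hab => ?_,
    evalSum_surjective (fun n => zero_lt_one.trans_le (hre n)) (fun μ f hf hf0 => ?_)
      (iSup_weightH_monogenic 1)⟩
  · -- `μ² - 2μ` is injective on the weights, because the sum of two different ones exceeds `2`
    have h : ((a : ℂ) - b) * ((m : ℂ) / 2 - 1 + a + ((m : ℂ) / 2 - 1 + b) - 2) = 0 := by
      linear_combination hab
    rcases mul_eq_zero.1 h with h | h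
    · exact_mod_cast sub_eq_zero.1 h
    · have h' : m + a + b = 4 := by
        have : (m : ℂ) + a + b = 4 := by linear_combination h
        exact_mod_cast this
      omega
  · obtain ⟨n, hn⟩ := exists_weight_monogenic hf hf0
    exact ⟨n, by simpa using hn⟩

instance finite_multSpace (μ : ℂ) : FiniteDimensional ℂ (MultSpace m 1 μ) :=
  have : FiniteDimensional ℂ (lowest (Monogenic m 1) μ) :=
    Submodule.finiteDimensional_inf_left _ _
  Module.Finite.equiv (Verma.homEquiv (Monogenic m 1) μ).symm

lemma finrank_multSpace (hm : 3 ≤ m) (μ : ℂ) : (finrank ℂ (MultSpace m 1 μ) : ℤ) =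
      m * (finrank ℂ (lowest (Monogenic m 0) (μ - 1)) + finrank ℂ (lowest (Monogenic m 0) (μ + 1)))
        - finrank ℂ (lowest (Monogenic m 0) μ) := by
  rw [(Verma.homEquiv (Monogenic m 1) μ).finrank_eq, finrank_lowest_one hm]

end SympBranch

end

theorem mainTheorem6 (m : ℕ) (hm : 6 ≤ m) :
    -- the `sl(2)`-modules `𝕍^∞_{m/2 - 1 + n}` are irreducible
    (∀ n : ℕ, LieModule.IsIrreducible ℂ SympBranch.SL2
      (SympBranch.Verma ((m : ℂ) / 2 - 1 + n))) ∧
    -- under `so(m) × sl(2)`, the space `𝕊_1^∞` is the direct sum of these modules, each tensored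
    -- with its multiplicity space, on which `so(m)` acts
    Nonempty (SympBranch.Monogenic m 1 ≃ₗ⁅ℂ, SympBranch.SOSL2 m⁆
      ⨁ n : ℕ, (SympBranch.MultSpace m 1 ((m : ℂ) / 2 - 1 + n) ⊗[ℂ]
        SympBranch.Verma ((m : ℂ) / 2 - 1 + n))) ∧
    -- the multiplicities are finite and given by
    (∀ n : ℕ, FiniteDimensional ℂ (SympBranch.MultSpace m 1 ((m : ℂ) / 2 - 1 + n))) ∧
    Module.finrank ℂ (SympBranch.MultSpace m 1 ((m : ℂ) / 2 - 1)) = m ∧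
    (Module.finrank ℂ (SympBranch.MultSpace m 1 ((m : ℂ) / 2)) : ℤ) = (m : ℤ) ^ 2 - 1 ∧
    ∀ a : ℕ, 1 ≤ a →
      (Module.finrank ℂ (SympBranch.MultSpace m 1 ((m : ℂ) / 2 + a)) : ℤ) =
        (m : ℤ) * ((Module.finrank ℂ (SympBranch.harmonics m (a - 1)) : ℤ) +
          (Module.finrank ℂ (SympBranch.harmonics m (a + 1)) : ℤ)) -
          (Module.finrank ℂ (SympBranch.harmonics m a) : ℤ) := by
  have hlt : ∀ {μ : ℂ}, μ.re < (m : ℝ) / 2 →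
      Module.finrank ℂ (SympBranch.lowest (SympBranch.Monogenic m 0) μ) = 0 :=
    SympBranch.finrank_lowest_zero_of_lt
  have h0 := SympBranch.finrank_lowest_zero (m := m) 0
  have h1 := SympBranch.finrank_lowest_zero (m := m) 1
  rw [SympBranch.finrank_harmonics_zero, Nat.cast_zero, add_zero] at h0
  rw [SympBranch.finrank_harmonics_one, Nat.cast_one] at h1
  refine ⟨fun n => SympBranch.Verma.isIrreducible ?_, ⟨?_⟩, fun n => inferInstance, ?_, ?_, ?_⟩
  · have h1 : (6 : ℝ) ≤ m := by exact_mod_cast hm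
    have h2 : (0 : ℝ) ≤ n := n.cast_nonneg
    simp only [Complex.add_re, Complex.sub_re, Complex.div_ofNat_re, Complex.natCast_re,
      Complex.one_re]
    linarith
  · -- evaluation maps the direct sum onto `𝕊_1^∞`; the isomorphism is its inverse
    let e := Equiv.ofBijective _ (SympBranch.evalSumLie_bijective (m := m) (by omega))
    exact LieModuleEquiv.symm
      { SympBranch.evalSumLie m 1 fun n => (m : ℂ) / 2 - 1 + n with
        invFun := e.symm
        left_inv := e.left_inv
        right_inv := e.right_inv }
  · -- the weights `m/2 - 2` and `m/2 - 1` do not occur on `𝒫(ℝ^m, ℂ)`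
    have h := SympBranch.finrank_multSpace (m := m) (by omega) ((m : ℂ) / 2 - 1)
    rw [sub_add_cancel, h0, hlt (by simp; linarith), hlt (by simp)] at h
    push_cast at h
    have h' := h.trans (show _ = (m : ℤ) by ring)
    exact_mod_cast h'
  · rw [SympBranch.finrank_multSpace (by omega), h0, h1, hlt (by simp)]
    push_cast
    ring
  · intro a ha
    rw [SympBranch.finrank_multSpace (by omega), SympBranch.finrank_lowest_zero,
      ← SympBranch.finrank_lowest_zero (a - 1), ← SympBranch.finrank_lowest_zero (a + 1)]
    rw [Nat.cast_sub ha, Nat.cast_one, Nat.cast_add, Nat.cast_one, add_assoc, add_sub_assoc]
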